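/- Resource terms. Simple terms $s\in\Delta$ and simple poly-terms $S$ are given by $s::=x\mid\lambda x.s\mid\langle s\rangle S$ and $S::=s_1\cdots s_n$ ($n\ge 0$, a finite multiset of simple terms), up to renaming of bound variables, with countably many variables. Let $\mathbb N\langle\Delta\rangle$ be the set of finite formal sums (finite multisets) of simple terms; all constructions of the syntax are extended to sums by linearity. One-step reduction, from simple terms to $\mathbb N\langle\Delta\rangle$, is the closure under the constructions of the syntax (reducing one term at a time inside a poly-term) of the rule $\langle\lambda x.t\rangle\, s_1\cdots s_n\to\partial_x(t;s_1\cdots s_n)$, where $\partial_x(t;s_1\cdots s_n)=\sum_{f\in\mathfrak S_n}t[s_{f(1)}/x_1,\dots,s_{f(n)}/x_n]$ if $x$ has exactly $n$ free occurrences $x_1,\dots,x_n$ in $t$, and $\partial_x(t;s_1\cdots s_n)=0$ otherwise. For $a,b\in\mathbb N\langle\Delta\rangle$ write $a\to_{01}b$ if $a=s_1+\dots+s_n$ and $b=b_1+\dots+b_n$ where, for each $i$, $b_i=s_i$ or $s_i\to b_i$; let $\to^*$ be the transitive closure of $\to_{01}$. A simple term is normal if it has no one-step reduct. A normal form of $s\in\Delta$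 is a $c\in\mathbb N\langle\Delta\rangle$ such that $s\to^*c$ and all terms of $c$ are normal. Write $t\le s$ if $s\to^*a$ for some $a\in\mathbb N\langle\Delta\rangle$ in which $t$ occurs. Finitary vectors. A set $e\subseteq\Delta$ is finitary if $\{s\in e\mid t\le s\}$ is finite for every $t\in\Delta$. Let $K$ be a field. A finitary vector is a family $a=(a_s)_{s\in\Delta}$ of elements of $K$, written $\sum_s a_s s$, whose support $\{s\mid a_s\neq 0\}$ is finitary. Write $a\to_{01}b$ for finitary vectors $a,b$ if there are $\alpha_i\in K$, $s_i\in\Delta$ and $c_i\in\mathbb N\langle\Delta\rangle$ ($i\in\mathbb N$) such that the set $\{s_i\mid i\in\mathbb N\}$ is finitary, each simple term equals $s_i$ for only finitely many $i$, $s_i\to_{01}c_i$ for every $i$, $a=\sum_i\alpha_i s_i$ and $b=\sum_i\alpha_i c_i$ (under these conditions all coefficients are given by finite sums). Let $\simeq$ be the equivalence relation generated by the transitive closure of this relation. **Proposition.** Every simple term $s$ has exactly one normal form $\mathrm{NF}(s)$. For a finitary vector $a$, let $\mathrm{NF}(a)=\sum_{s\in\Delta}a_s\,\mathrm{NF}(s)$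 (all coefficients are given by finite sums, and the result is a finitary vector). If $a$ and $b$ are finitary vectors with $a\simeq b$, then $\mathrm{NF}(a)=\mathrm{NF}(b)$. -/

import Mathlib

/-! ### Raw syntax of the resource lambda-calculus (de Bruijn indices, bags as lists) -/

/-- The two syntactic sorts: simple terms and simple poly-terms. -/
inductive Kind : Type
  | term
  | poly

/-- Raw simple terms and raw simple poly-terms. Variables are de Bruijn indices, so terms are
taken up to renaming of bound variables, and the free variables form a countable set.
`one` is the empty poly-term and `mul s S` adds the term `s` to the poly-term `S`; the order of
the factors is forgotten by `Pre.Equiv` below. -/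
inductive Pre : Kind → Type
  | var (n : ℕ) : Pre Kind.term
  | lam (s : Pre Kind.term) : Pre Kind.term
  | app (s : Pre Kind.term) (S : Pre Kind.poly) : Pre Kind.term
  | one : Pre Kind.poly
  | mul (s : Pre Kind.term) (S : Pre Kind.poly) : Pre Kind.poly

namespace Pre

/-- The least congruence that makes the product of terms in poly-terms commutative, so that
poly-terms (hereditarily) become multisets of terms. -/
inductive Equiv : {κ : Kind} → Pre κ → Pre κ → Prop
  | refl {κ : Kind} (p : Pre κ) : Equiv p p
  | symm {κ : Kind} {p q : Pre κ} : Equiv p q → Equiv q p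
  | trans {κ : Kind} {p q r : Pre κ} : Equiv p q → Equiv q r → Equiv p r
  | lam {s t : Pre Kind.term} : Equiv s t → Equiv (lam s) (lam t)
  | app {s t : Pre Kind.term} {S T : Pre Kind.poly} :
      Equiv s t → Equiv S T → Equiv (app s S) (app t T)
  | mul {s t : Pre Kind.term} {S T : Pre Kind.poly} :
      Equiv s t → Equiv S T → Equiv (mul s S) (mul t T)
  | swap (s t : Pre Kind.term) (S : Pre Kind.poly) :
      Equiv (mul s (mul t S)) (mul t (mul s S))

/-- The terms `s₁, …, sₙ` of the poly-term `s₁ ⋯ sₙ`. -/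
def toList : Pre Kind.poly → List (Pre Kind.term)
  | one => []
  | mul s S => s :: toList S

/-- `p.lift d c` adds `d` to all free indices of `p` that are at least `c`. -/
def lift (d : ℕ) : {κ : Kind} → Pre κ → ℕ → Pre κ
  | _, var n, c => if n < c then var n else var (n + d)
  | _, lam s, c => lam (lift d s (c + 1))
  | _, app s S, c => app (lift d s c) (lift d S c)
  | _, one, _ => one
  | _, mul s S, c => mul (lift d s c) (lift d S c)

/-- `p.occ k` is the number of free occurrences of the variable `k` in `p`. -/
def occ : {κ : Kind} → Pre κ → ℕ → ℕ
  | _, var n, k => if n = k then 1 else 0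
  | _, lam s, k => occ s (k + 1)
  | _, app s S, k => occ s k + occ S k
  | _, one, _ => 0
  | _, mul s S, k => occ s k + occ S k

/-- `p.fill k u` removes the variable `k` from the context of `p`, replacing its free occurrences,
numbered `0, 1, 2, …` from left to right, by `u 0, u 1, u 2, …`: each occurrence receives its own
term. The terms `u i` are lifted when they go under binders (`k` counts the binders crossed when
one starts from `k = 0`). -/
def fill : {κ : Kind} → Pre κ → ℕ → (ℕ → Pre Kind.term) → Pre κ
  | _, var n, k, u => if n < k then var n else if n = k then (u 0).lift k 0 else var (n - 1)
  | _, lam s, k, u => lam (fill s (k + 1) u)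
  | _, app s S, k, u => app (fill s k u) (fill S k fun i => u (occ s k + i))
  | _, one, _, _ => one
  | _, mul s S, k, u => mul (fill s k u) (fill S k fun i => u (occ s k + i))

/-- Differential substitution of the poly-term `S = s₁ ⋯ sₙ` for the variable `0` in `t`: it is `0`
if the number of free occurrences of this variable in `t` is not `n`, and otherwise the
sum, over all permutations `f` of `n` letters, of the terms obtained by replacing the `i`-th
occurrence by `s_{f i}`. (The value `var 0` for `i ≥ n` is never used.) -/
def msubst (t : Pre Kind.term) (S : Pre Kind.poly) : Multiset (Pre Kind.term) :=
  if t.occ 0 = S.toList.length then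
    ∑ f : Equiv.Perm (Fin S.toList.length),
      {t.fill 0 fun i => if h : i < S.toList.length then S.toList.get (f ⟨i, h⟩) else var 0}
  else 0

/-- One-step reduction, simultaneously for terms and poly-terms; the result is a finite multiset,
that is a finite formal sum with coefficients in `ℕ`. -/
inductive Step : {κ : Kind} → Pre κ → Multiset (Pre κ) → Prop
  | lam {s : Pre Kind.term} {a : Multiset (Pre Kind.term)} :
      Step s a → Step (lam s) (a.map lam)
  | fn {s : Pre Kind.term} {a : Multiset (Pre Kind.term)} (S : Pre Kind.poly) :
      Step s a → Step (app s S) (a.map fun s' => app s' S)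
  | arg (s : Pre Kind.term) {S : Pre Kind.poly} {A : Multiset (Pre Kind.poly)} :
      Step S A → Step (app s S) (A.map fun S' => app s S')
  | beta (t : Pre Kind.term) (S : Pre Kind.poly) : Step (app (lam t) S) (msubst t S)
  | head {s : Pre Kind.term} {b : Multiset (Pre Kind.term)} (S : Pre Kind.poly) :
      Step s b → Step (mul s S) (b.map fun s' => mul s' S)
  | tail (s : Pre Kind.term) {S : Pre Kind.poly} {B : Multiset (Pre Kind.poly)} :
      Step S B → Step (mul s S) (B.map fun S' => mul s S')

/-- The congruence `Pre.Equiv` on raw terms, as a setoid. -/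
def termSetoid : Setoid (Pre Kind.term) where
  r := Equiv
  iseqv := ⟨Equiv.refl, Equiv.symm, Equiv.trans⟩

end Pre

/-! ### Simple terms, reduction, and the order -/

/-- The set of simple terms. -/
def STerm : Type := Quotient Pre.termSetoid

namespace STerm

/-- The simple term represented by a raw term. -/
def mk (p : Pre Kind.term) : STerm := Quotient.mk Pre.termSetoid p

/-- One-step reduction of a simple term to a finite formal sum of simple terms. -/
def Step (s : STerm) (b : Multiset STerm) : Prop :=
  ∃ (p : Pre Kind.term) (m : Multiset (Pre Kind.term)), mk p = s ∧ p.Step m ∧ m.map mk = b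

/-- A simple term is normal if it has no one-step reduct. -/
def Normal (s : STerm) : Prop := ∀ b : Multiset STerm, ¬ s.Step b

end STerm

/-- The linear extension of `ρ ⊆ E × ℕ⟨F⟩` to `ℕ⟨E⟩ × ℕ⟨F⟩`: sums of finite families
of pairs of `ρ`. -/
def NatExt {E F : Type*} (ρ : E → Multiset F → Prop) (a : Multiset E) (b : Multiset F) : Prop :=
  ∃ l : List (E × Multiset F),
    (∀ p ∈ l, ρ p.1 p.2) ∧ ((l.map Prod.fst : List E) : Multiset E) = a ∧ (l.map Prod.snd).sum = b

/-- The reflexive reduction relation: some of the summands are reduced by one step. -/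
def Red01 : Multiset STerm → Multiset STerm → Prop :=
  NatExt fun s b => b = {s} ∨ s.Step b

/-- The transitive closure of `Red01`. -/
def Red : Multiset STerm → Multiset STerm → Prop := Relation.TransGen Red01

namespace STerm

/-- `c` is a normal form of `s`: `s` reduces to `c`, and all terms of `c` are normal. -/
def IsNormalForm (s : STerm) (c : Multiset STerm) : Prop :=
  Red {s} c ∧ ∀ t ∈ c, t.Normal

open Classical in
/-- The normal form of a simple term (it exists and is unique; the value `0` that
would be taken otherwise is not used). -/
noncomputable def nf (s : STerm) : Multiset STerm :=
  if h : ∃ c, s.IsNormalForm c then h.choose else 0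

/-- `up t` is the set of the terms `s ≥ t`, where `t ≤ s` means that `s` reduces to a sum
in which `t` occurs. -/
def up (t : STerm) : Set STerm := {s | ∃ a : Multiset STerm, Red {s} a ∧ t ∈ a}

end STerm

/-! ### The finiteness structure and finitary vectors -/

/-- The orthogonal of a collection of subsets. -/
def orth {I : Type*} (F : Set (Set I)) : Set (Set I) := {e' | ∀ e ∈ F, (e ∩ e').Finite}

/-- The finitary sets of simple terms: those which meet every `up t` in a finite set. -/
def Finitary : Set (Set STerm) := orth (Set.range STerm.up)

theorem Finitary.mono {e f : Set STerm} (hf : f ∈ Finitary) (h : e ⊆ f) : e ∈ Finitary :=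
  fun x hx => (hf x hx).subset (Set.inter_subset_inter_right x h)

theorem Finitary.union {e f : Set STerm} (he : e ∈ Finitary) (hf : f ∈ Finitary) :
    e ∪ f ∈ Finitary := fun x hx => by
  rw [Set.inter_union_distrib_left]
  exact (he x hx).union (hf x hx)

/-- The vector space of the (possibly infinite) linear combinations of simple terms
whose support is finitary. -/
def FinVec (K : Type*) [Field K] : Submodule K (STerm → K) where
  carrier := {a | Function.support a ∈ Finitary}
  add_mem' ha hb := Finitary.mono (Finitary.union ha hb) (Function.support_add _ _)
  zero_mem' := fun x _ => by simp
  smul_mem' c a ha := Finitary.mono ha (Function.support_const_smul_subset c a)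

/-! ### Normal forms of finitary vectors -/

theorem STerm.nf_le {s t : STerm} (h : t ∈ s.nf) : s ∈ t.up ∧ t.Normal := by
  unfold STerm.nf at h
  split_ifs at h with hc
  · exact ⟨⟨_, hc.choose_spec.1, h⟩, hc.choose_spec.2 t h⟩
  · simp at h

theorem STerm.Normal.red01 {u : STerm} (hu : u.Normal) {b : Multiset STerm}
    (h : Red01 {u} b) : b = {u} := by
  obtain ⟨l, hl, h1, rfl⟩ := h
  have h2 : l.map Prod.fst = [u] := by
    simpa [← Multiset.coe_singleton, List.perm_singleton] using h1
  obtain ⟨p, rfl, hp⟩ : ∃ p, l = [p] ∧ p.1 = u := by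
    simpa [List.map_eq_singleton_iff] using h2
  rcases hl p (by simp) with h3 | h3
  · simpa [hp] using h3
  · exact absurd h3 (hp ▸ hu _)

theorem STerm.Normal.red {u : STerm} (hu : u.Normal) {b : Multiset STerm}
    (h : Red {u} b) : b = {u} := by
  induction h with
  | single h => exact hu.red01 h
  | tail _ h ih => subst ih; exact hu.red01 h

/-- Every set of normal terms is finitary. -/
theorem finitary_of_normal {e : Set STerm} (he : ∀ u ∈ e, u.Normal) : e ∈ Finitary := by
  rintro _ ⟨t, rfl⟩
  refine (Set.finite_singleton t).subset ?_
  rintro u ⟨⟨a, ha, hta⟩, hu⟩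
  rw [(he u hu).red ha] at hta
  exact (Multiset.mem_singleton.1 hta).symm

open Classical in
/-- The sum which defines a coefficient of the normal form of a finitary vector is finite. -/
theorem nf_sum_finite {K : Type*} [Field K] (a : FinVec K) (t : STerm) :
    (Function.support fun s : STerm => a.1 s * (s.nf.count t : K)).Finite := by
  refine (a.2 t.up ⟨t, rfl⟩).subset fun s hs => ?_
  refine ⟨(STerm.nf_le (Multiset.count_ne_zero.1 fun h0 => hs ?_)).1, left_ne_zero_of_mul hs⟩
  simp [h0]

open Classical in
/-- The normal form `∑ₛ aₛ NF(s)` of a finitary vector `a`; all the sums are finite by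
`nf_sum_finite`, and the result is again a finitary vector. -/
noncomputable def NF {K : Type*} [Field K] (a : FinVec K) : FinVec K :=
  ⟨fun t => ∑ᶠ s : STerm, a.1 s * (s.nf.count t : K), finitary_of_normal fun t ht => by
    obtain ⟨s, hs⟩ : ∃ s : STerm, a.1 s * (s.nf.count t : K) ≠ 0 := by
      by_contra! h
      exact ht (by simp [h])
    have ht' : t ∈ s.nf := Multiset.count_ne_zero.1 fun h0 => hs (by simp [h0])
    exact (STerm.nf_le ht').2⟩

/-! ### Reduction of finitary vectors -/

open Classical in
/-- One step of reduction of finitary vectors: `a = ∑ᵢ αᵢ sᵢ` and `b = ∑ᵢ αᵢ cᵢ`, where the terms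
`sᵢ` form a finitary set, each term is `sᵢ` for finitely many `i` only, and each `sᵢ` reduces to
`cᵢ` in at most one step. All sums are finite in each coordinate, see `vecStep_sum_finite`. -/
def VecStep {K : Type*} [Field K] (a b : FinVec K) : Prop :=
  ∃ (α : ℕ → K) (s : ℕ → STerm) (c : ℕ → Multiset STerm),
    Set.range s ∈ Finitary ∧
    (∀ t : STerm, {i | s i = t}.Finite) ∧
    (∀ i, Red01 {s i} (c i)) ∧
    (∀ t : STerm, a.1 t = ∑ᶠ i, if s i = t then α i else 0) ∧
    (∀ t : STerm, b.1 t = ∑ᶠ i, α i * ((c i).count t : K))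

open Classical in
theorem vecStep_sum_finite {K : Type*} [Field K] {α : ℕ → K} {s : ℕ → STerm}
    {c : ℕ → Multiset STerm} (hs : Set.range s ∈ Finitary)
    (hfin : ∀ t : STerm, {i | s i = t}.Finite) (hc : ∀ i, Red01 {s i} (c i)) (t : STerm) :
    (Function.support fun i => if s i = t then α i else 0).Finite ∧
    (Function.support fun i => α i * ((c i).count t : K)).Finite := by
  constructor
  · exact (hfin t).subset fun i hi => by
      by_contra h
      exact hi (if_neg h)
  · refine ((hs t.up ⟨t, rfl⟩).biUnion fun u _ => hfin u).subset fun i hi => ?_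
    have ht : t ∈ c i := Multiset.count_ne_zero.1 fun h0 => hi (by simp [h0])
    simp only [Set.mem_iUnion]
    exact ⟨s i, ⟨⟨c i, Relation.TransGen.single (hc i), ht⟩, i, rfl⟩, rfl⟩

/-- Reduction of finitary vectors: the transitive closure of `VecStep`. -/
def VecRed {K : Type*} [Field K] : FinVec K → FinVec K → Prop := Relation.TransGen VecStep

/-- The equivalence relation generated by the reduction of finitary vectors. -/
def VecEquiv {K : Type*} [Field K] : FinVec K → FinVec K → Prop := Relation.EqvGen VecRed

/-! Uniqueness of normal forms is a Tait–Martin-Löf confluence argument in Takahashi's form;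
existence comes from a size that decreases; the statement on vectors follows because `nf` is
additive and invariant under reduction.

The sum over permutations in `msubst` resists induction, so it is replaced by `bet`: differentiate
the body once along each factor of the bag, then set the variable to zero. `bet_singleton` shows
that the two agree. The operators `der` and `zer` are additive and satisfy a product rule, the
symmetry of second derivatives (`der_der`) and commutation laws with erasure (`zer_zer`,
`bind_zer_der`). From these, `bet_bind_der` and `bet_bind_zer` play the role of the substitution
lemma.

Parallel reduction `Par` then respects `der`, `zer` and `bet`, hence the triangle property
`Par.dev`: every parallel reduct reduces in parallel to the complete development. All this concerns
raw terms. Only `dev` and the size have to be shown invariant under permutation of bags, since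
reductions of simple terms are defined by choosing representatives. Everything reached from `x`
reduces in parallel to an iterated development of `x`; a normal sum admits no other parallel reduct
than itself, so it equals such an iterate, and it is fixed by further developments.

Contracting a redex destroys an application and an abstraction and uses each argument at most once,
so all summands of a reduct are smaller and normal forms exist.

For vectors, the coefficient at `t` of the normal form involves only the finitely many indices `i`
with `s i ≥ t`, so the sums can be exchanged and the claim reduces to `nf (s i) = ∑ nf u`, `u`
ranging over `c i`. -/

/-! ### Bilinear operations on finite sums -/

/-- The bilinear extension of a binary operation to multisets. -/
def Multiset.map₂ {α β γ : Type*} (f : α → β → γ) (a : Multiset α) (b : Multiset β) :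
    Multiset γ := a.bind fun x => b.map (f x)

namespace Multiset

variable {α β γ δ : Type*} (f : α → β → γ)

@[simp] theorem map₂_zero_left (b : Multiset β) : map₂ f 0 b = 0 := by simp [map₂]

@[simp] theorem map₂_zero_right (a : Multiset α) : map₂ f a 0 = 0 := by simp [map₂]

theorem map₂_add_left (a a' : Multiset α) (b : Multiset β) :
    map₂ f (a + a') b = map₂ f a b + map₂ f a' b := by simp [map₂]

theorem map₂_add_right (a : Multiset α) (b b' : Multiset β) :
    map₂ f a (b + b') = map₂ f a b + map₂ f a b' := by simp [map₂, bind_add]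

@[simp] theorem map₂_singleton_left (x : α) (b : Multiset β) :
    map₂ f {x} b = b.map (f x) := by simp [map₂]

@[simp] theorem map₂_singleton_right (a : Multiset α) (y : β) :
    map₂ f a {y} = a.map (f · y) := by simp [map₂, bind_singleton]

theorem map₂_bind_left (a : Multiset δ) (g : δ → Multiset α) (b : Multiset β) :
    map₂ f (a.bind g) b = a.bind fun x => map₂ f (g x) b := by
  simp [map₂, bind_assoc]

theorem map₂_bind_right (a : Multiset α) (g : δ → Multiset β) (b : Multiset δ) :
    map₂ f a (b.bind g) = b.bind fun y => map₂ f a (g y) := by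
  simp [map₂, map_bind, bind_bind a b]

theorem bind_map₂ (g : γ → Multiset δ) (a : Multiset α) (b : Multiset β) :
    (map₂ f a b).bind g = a.bind fun x => b.bind fun y => g (f x y) := by
  simp [map₂, bind_assoc, bind_map]

theorem map_map₂ (g : γ → δ) (a : Multiset α) (b : Multiset β) :
    (map₂ f a b).map g = map₂ (fun x y => g (f x y)) a b := by
  simp [map₂, map_bind]

theorem map₂_map {α' β' : Type*} (g : α' → α) (h : β' → β) (a : Multiset α') (b : Multiset β') :
    map₂ f (a.map g) (b.map h) = map₂ (fun x y => f (g x) (h y)) a b := by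
  simp [map₂, bind_map]

/-- Product rule, checked on pairs and extended by bilinearity; for derivatives `h₁` and `h₂` are
the singleton maps. -/
theorem bind_map₂_of_leibniz {α' β' γ' : Type*} {f : α → β → γ} {f' : α' → β' → γ'}
    {g : γ → Multiset γ'} {g₁ : α → Multiset α'} {g₂ : β → Multiset β'}
    {h₁ : α → Multiset α'} {h₂ : β → Multiset β'}
    (h : ∀ x y, g (f x y) = map₂ f' (g₁ x) (h₂ y) + map₂ f' (h₁ x) (g₂ y))
    (a : Multiset α) (b : Multiset β) :
    (map₂ f a b).bind g =
      map₂ f' (a.bind g₁) (b.bind h₂) + map₂ f' (a.bind h₁) (b.bind g₂) := by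
  simp only [bind_map₂, h, bind_add, map₂_bind_left, map₂_bind_right,
    bind_bind b a]

theorem bind_map₂_of_mul {α' β' γ' : Type*} {f : α → β → γ} {f' : α' → β' → γ'}
    {g : γ → Multiset γ'} {g₁ : α → Multiset α'} {g₂ : β → Multiset β'}
    (h : ∀ x y, g (f x y) = map₂ f' (g₁ x) (g₂ y)) (a : Multiset α) (b : Multiset β) :
    (map₂ f a b).bind g = map₂ f' (a.bind g₁) (b.bind g₂) := by
  simp only [bind_map₂, h, map₂_bind_left, map₂_bind_right, bind_bind b a]

@[simp] theorem bind_singleton_self (a : Multiset α) : (a.bind fun x => {x}) = a := by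
  simp [bind_singleton a (fun x => x)]

end Multiset

namespace Pre

open Multiset

/-! ### Lifting -/

theorem lift_lift_comm {κ : Kind} (p : Pre κ) {i c : ℕ} (h : i ≤ c) :
    lift 1 (lift 1 p i) (c + 1) = lift 1 (lift 1 p c) i := by
  induction p generalizing i c with
  | var n => simp only [lift]; split_ifs <;> simp only [lift] <;> split_ifs <;> first | rfl | omega
  | lam s ih => simp [lift, ih (Nat.succ_le_succ h)]
  | app s S ih ih' => simp [lift, ih h, ih' h]
  | one => rfl
  | mul s S ih ih' => simp [lift, ih h, ih' h]

theorem lift_one_lift {κ : Kind} (p : Pre κ) (d c : ℕ) :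
    lift 1 (lift d p c) c = lift (d + 1) p c := by
  induction p generalizing c with
  | var n => simp only [lift]; split_ifs <;> simp only [lift] <;> split_ifs <;> first | rfl | omega
  | lam s ih => simp [lift, ih]
  | app s S ih ih' => simp [lift, ih, ih']
  | one => rfl
  | mul s S ih ih' => simp [lift, ih, ih']

/-! ### Linear derivative and erasure of a variable -/

/-- The sum of all ways of replacing exactly one free occurrence of the variable `k` of `p` by a
summand of `A`. -/
def der : {κ : Kind} → Pre κ → ℕ → Multiset (Pre Kind.term) → Multiset (Pre κ)
  | _, var n, k, A => if n = k then A else 0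
  | _, lam s, k, A => (der s (k + 1) (A.map (lift 1 · 0))).map lam
  | _, app s S, k, A => (der s k A).map (app · S) + (der S k A).map (app s)
  | _, one, _, _ => 0
  | _, mul s S, k, A => (der s k A).map (mul · S) + (der S k A).map (mul s)

/-- Substitution of `0` for the variable `k`, which is removed from the context. -/
def zer : {κ : Kind} → Pre κ → ℕ → Multiset (Pre κ)
  | _, var n, k => if n < k then {var n} else if n = k then 0 else {var (n - 1)}
  | _, lam s, k => (zer s (k + 1)).map lam
  | _, app s S, k => map₂ app (zer s k) (zer S k)
  | _, one, _ => {one}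
  | _, mul s S, k => map₂ mul (zer s k) (zer S k)

theorem der_zero {κ : Kind} (p : Pre κ) (k : ℕ) : der p k 0 = 0 := by
  induction p generalizing k <;> simp_all [der]

theorem der_add {κ : Kind} (p : Pre κ) (k : ℕ) (A B : Multiset (Pre Kind.term)) :
    der p k (A + B) = der p k A + der p k B := by
  induction p generalizing k A B with
  | var n => simp only [der]; split_ifs <;> simp
  | lam s ih => simp [der, ih]
  | app s S ih ih' => simp only [der, ih, ih', Multiset.map_add]; abel
  | one => rfl
  | mul s S ih ih' => simp only [der, ih, ih', Multiset.map_add]; abel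

theorem der_bind {κ : Kind} {α : Type*} (p : Pre κ) (k : ℕ) (a : Multiset α)
    (f : α → Multiset (Pre Kind.term)) :
    der p k (a.bind f) = a.bind fun x => der p k (f x) := by
  induction a using Multiset.induction_on with
  | empty => simp [der_zero]
  | cons x a ih => simp [der_add, ih]

theorem map₂_app_bind_der (a : Multiset (Pre Kind.term)) (b : Multiset (Pre Kind.poly)) (k : ℕ)
    (A : Multiset (Pre Kind.term)) :
    (map₂ app a b).bind (der · k A) =
      map₂ app (a.bind (der · k A)) b + map₂ app a (b.bind (der · k A)) := by
  simpa using bind_map₂_of_leibniz (f' := app) (g := (der · k A)) (g₁ := (der · k A))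
    (g₂ := (der · k A)) (h₁ := fun x => {x}) (h₂ := fun x => {x}) (by simp [der]) a b

theorem map₂_mul_bind_der (a : Multiset (Pre Kind.term)) (b : Multiset (Pre Kind.poly)) (k : ℕ)
    (A : Multiset (Pre Kind.term)) :
    (map₂ mul a b).bind (der · k A) =
      map₂ mul (a.bind (der · k A)) b + map₂ mul a (b.bind (der · k A)) := by
  simpa using bind_map₂_of_leibniz (f' := mul) (g := (der · k A)) (g₁ := (der · k A))
    (g₂ := (der · k A)) (h₁ := fun x => {x}) (h₂ := fun x => {x}) (by simp [der]) a b

theorem map₂_app_bind_zer (a : Multiset (Pre Kind.term)) (b : Multiset (Pre Kind.poly)) (k : ℕ) :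
    (map₂ app a b).bind (zer · k) = map₂ app (a.bind (zer · k)) (b.bind (zer · k)) :=
  bind_map₂_of_mul (g := (zer · k)) (fun _ _ => rfl) a b

theorem map₂_mul_bind_zer (a : Multiset (Pre Kind.term)) (b : Multiset (Pre Kind.poly)) (k : ℕ) :
    (map₂ mul a b).bind (zer · k) = map₂ mul (a.bind (zer · k)) (b.bind (zer · k)) :=
  bind_map₂_of_mul (g := (zer · k)) (fun _ _ => rfl) a b

theorem der_app (s : Pre Kind.term) (S : Pre Kind.poly) (k : ℕ) (A : Multiset (Pre Kind.term)) :
    der (app s S) k A = map₂ app (der s k A) {S} + map₂ app {s} (der S k A) := by simp [der]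

theorem der_mul (s : Pre Kind.term) (S : Pre Kind.poly) (k : ℕ) (A : Multiset (Pre Kind.term)) :
    der (mul s S) k A = map₂ mul (der s k A) {S} + map₂ mul {s} (der S k A) := by simp [der]

/-! ### Commutations -/

theorem map_lift_lift (A : Multiset (Pre Kind.term)) (c : ℕ) :
    (A.map (lift 1 · c)).map (lift 1 · 0) = (A.map (lift 1 · 0)).map (lift 1 · (c + 1)) := by
  simp [lift_lift_comm]

/-- Lifting at `c` makes room for a new variable `c`, which the variable `i` must skip: hence the
conditional index. -/
theorem map_lift_der {κ : Kind} (p : Pre κ) (i c : ℕ) (B : Multiset (Pre Kind.term)) :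
    (der p i B).map (lift 1 · c) =
      der (lift 1 p c) (if i < c then i else i + 1) (B.map (lift 1 · c)) := by
  induction p generalizing i c B with
  | var n =>
    simp only [der, lift]
    split_ifs <;> simp only [der] <;> split_ifs <;> first | rfl | omega
  | lam s ih =>
    simp only [der, lift, map_lift_lift]
    rw [show (if i < c then i else i + 1) + 1 = if i + 1 < c + 1 then i + 1 else i + 1 + 1 by
      split_ifs <;> omega, ← ih]
    simp [lift, Function.comp_def]
  | app s S ih ih' =>
    simp only [der, lift, ← ih, ← ih']
    simp [lift, Function.comp_def]
  | one => rfl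
  | mul s S ih ih' =>
    simp only [der, lift, ← ih, ← ih']
    simp [lift, Function.comp_def]

theorem der_lift_self {κ : Kind} (p : Pre κ) (c : ℕ) (A : Multiset (Pre Kind.term)) :
    der (lift 1 p c) c A = 0 := by
  induction p generalizing c A with
  | var n => simp only [lift]; split_ifs <;> simp only [der] <;> split_ifs <;> first | rfl | omega
  | lam s ih => simp [der, lift, ih]
  | app s S ih ih' => simp [der, lift, ih, ih']
  | one => rfl
  | mul s S ih ih' => simp [der, lift, ih, ih']

theorem zer_lift_self {κ : Kind} (p : Pre κ) (c : ℕ) : zer (lift 1 p c) c = {p} := by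
  induction p generalizing c with
  | var n =>
    simp only [lift]; split_ifs <;> simp only [zer] <;> split_ifs <;> first | rfl | omega
  | lam s ih => simp [zer, lift, ih]
  | app s S ih ih' => simp [zer, lift, ih, ih']
  | one => rfl
  | mul s S ih ih' => simp [zer, lift, ih, ih']

theorem map_lift_zer_of_le {κ : Kind} (p : Pre κ) {k c : ℕ} (h : k ≤ c) :
    (zer p k).map (lift 1 · c) = zer (lift 1 p (c + 1)) k := by
  induction p generalizing k c with
  | var n =>
    simp only [lift, zer]
    split_ifs <;> simp only [zer, lift, Multiset.map_singleton, Multiset.map_zero] <;>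
      split_ifs <;> first | rfl | omega | (congr; omega)
  | lam s ih => simp [zer, lift, ← ih (Nat.succ_le_succ h), Function.comp_def]
  | app s S ih ih' => simp [zer, lift, ← ih h, ← ih' h, map_map₂, map₂_map]
  | one => rfl
  | mul s S ih ih' => simp [zer, lift, ← ih h, ← ih' h, map_map₂, map₂_map]

theorem map_lift_zer_of_ge {κ : Kind} (p : Pre κ) {k c : ℕ} (h : c ≤ k) :
    (zer p k).map (lift 1 · c) = zer (lift 1 p c) (k + 1) := by
  induction p generalizing k c with
  | var n =>
    simp only [lift, zer]
    split_ifs <;> simp only [zer, lift, Multiset.map_singleton, Multiset.map_zero] <;>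
      split_ifs <;> first | rfl | omega | (congr; omega)
  | lam s ih => simp [zer, lift, ← ih (Nat.succ_le_succ h), Function.comp_def]
  | app s S ih ih' => simp [zer, lift, ← ih h, ← ih' h, map_map₂, map₂_map]
  | one => rfl
  | mul s S ih ih' => simp [zer, lift, ← ih h, ← ih' h, map_map₂, map₂_map]

theorem zer_zer {κ : Kind} (p : Pre κ) {i k : ℕ} (h : i ≤ k) :
    (zer p i).bind (zer · k) = (zer p (k + 1)).bind (zer · i) := by
  induction p generalizing k i with
  | var n =>
    simp only [zer]
    split_ifs <;> simp only [zer, Multiset.singleton_bind, Multiset.zero_bind] <;>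
      split_ifs <;> first | rfl | omega
  | lam s ih =>
    simp only [zer, Multiset.bind_map]
    simp only [← Multiset.map_bind, ih (Nat.succ_le_succ h)]
  | app s S ih ih' => simp only [zer, map₂_app_bind_zer, ih h, ih' h]
  | one => rfl
  | mul s S ih ih' => simp only [zer, map₂_mul_bind_zer, ih h, ih' h]

/-- Erasure is a substitution, so it passes through a derivative provided that it also acts on the
inserted sum. Here `i` is counted after `j` is removed; the conditional is its index before removal,
never equal to `j`. -/
theorem bind_zer_der {κ : Kind} (p : Pre κ) (i j : ℕ) (B : Multiset (Pre Kind.term)) :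
    (der p (if i < j then i else i + 1) B).bind (zer · j) =
      (zer p j).bind (der · i (B.bind (zer · j))) := by
  induction p generalizing i j B with
  | var n =>
    simp only [der, zer]
    split_ifs <;> simp only [der, Multiset.singleton_bind, Multiset.zero_bind] <;>
      (try split_ifs) <;> first | rfl | omega
  | lam s ih =>
    have hB : (B.map (lift 1 · 0)).bind (zer · (j + 1)) =
        (B.bind (zer · j)).map (lift 1 · 0) := by
      simp [Multiset.bind_map, Multiset.map_bind, map_lift_zer_of_ge]
    simp only [der, zer, Multiset.bind_map]
    rw [show (if i < j then i else i + 1) + 1 = if i + 1 < j + 1 then i + 1 else i + 1 + 1 by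
      split_ifs <;> omega]
    simp only [← Multiset.map_bind, ih, hB]
  | app s S ih ih' =>
    simp only [der_app, zer, Multiset.add_bind, map₂_app_bind_zer, ih, ih', map₂_app_bind_der,
      Multiset.singleton_bind]
  | one => simp [der, zer]
  | mul s S ih ih' =>
    simp only [der_mul, zer, Multiset.add_bind, map₂_mul_bind_zer, ih, ih', map₂_mul_bind_der,
      Multiset.singleton_bind]

/-- A second derivative hits either an old occurrence or the term just inserted. The contributions
with two old occurrences are symmetric, and each side adds the correction that the other one already
contains. The case `i = j` is included. -/
theorem der_der {κ : Kind} (p : Pre κ) (i j : ℕ) (A B : Multiset (Pre Kind.term)) :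
    (der p i B).bind (der · j A) + der p j (A.bind (der · i B)) =
      (der p j A).bind (der · i B) + der p i (B.bind (der · j A)) := by
  induction p generalizing i j A B with
  | var n =>
    simp only [der]
    split_ifs <;> simp [add_comm]
  | lam s ih =>
    have h (A B : Multiset (Pre Kind.term)) (i : ℕ) : (A.bind (der · i B)).map (lift 1 · 0) =
        (A.map (lift 1 · 0)).bind (der · (i + 1) (B.map (lift 1 · 0))) := by
      simp [Multiset.bind_map, Multiset.map_bind, map_lift_der]
    simp only [der, Multiset.bind_map]
    simp only [← Multiset.map_bind, h, ← Multiset.map_add, ih]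
  | app s S ih ih' =>
    have h₁ := congrArg (map₂ app · {S}) (ih i j A B)
    have h₂ := congrArg (map₂ app {s}) (ih' i j A B)
    simp only [map₂_add_left, map₂_add_right] at h₁ h₂
    simp only [der_app, Multiset.add_bind, map₂_app_bind_der, Multiset.singleton_bind]
    grind
  | one => rfl
  | mul s S ih ih' =>
    have h₁ := congrArg (map₂ mul · {S}) (ih i j A B)
    have h₂ := congrArg (map₂ mul {s}) (ih' i j A B)
    simp only [map₂_add_left, map₂_add_right] at h₁ h₂
    simp only [der_mul, Multiset.add_bind, map₂_mul_bind_der, Multiset.singleton_bind]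
    grind

end Pre

namespace Pre

open Multiset

/-! ### Linear substitution of a poly-term for the variable `0` -/

/-- Differential substitution of the poly-term `S` for the variable `0`, extended by linearity:
one derivative for each factor of `S`, then erasure of the variable. -/
def bet : Pre Kind.poly → Multiset (Pre Kind.term) → Multiset (Pre Kind.term)
  | one, a => a.bind (zer · 0)
  | mul s S, a => bet S (a.bind (der · 0 {lift 1 s 0}))

theorem bet_zero : ∀ S : Pre Kind.poly, bet S 0 = 0
  | one => by simp [bet]
  | mul _ S => by simp [bet, bet_zero S]

theorem bet_add : ∀ (S : Pre Kind.poly) (a b : Multiset (Pre Kind.term)),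
    bet S (a + b) = bet S a + bet S b
  | one, a, b => by simp [bet]
  | mul s S, a, b => by simp [bet, bet_add S]

theorem bet_bind {α : Type*} (S : Pre Kind.poly) (a : Multiset α)
    (f : α → Multiset (Pre Kind.term)) :
    bet S (a.bind f) = a.bind fun x => bet S (f x) := by
  induction a using Multiset.induction_on with
  | empty => simp [bet_zero]
  | cons x a ih => simp [bet_add, ih]

theorem map_lift_bet : ∀ (S : Pre Kind.poly) (a : Multiset (Pre Kind.term)) (c : ℕ),
    (bet S a).map (lift 1 · c) = bet (lift 1 S c) (a.map (lift 1 · (c + 1)))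
  | one, a, c => by
    simp [bet, lift, Multiset.map_bind, Multiset.bind_map, map_lift_zer_of_le]
  | mul s S, a, c => by
    simp [bet, lift, map_lift_bet S, Multiset.map_bind, Multiset.bind_map, map_lift_der,
      lift_lift_comm]

/-- Product rule for substitution: an occurrence of `k` in the result comes from the body, where it
is `k + 1` beside the substituted variable `0`, or from one of the factors of `S`. -/
theorem bet_bind_der : ∀ (S : Pre Kind.poly) (a : Multiset (Pre Kind.term)) (k : ℕ)
    (A : Multiset (Pre Kind.term)),
    (bet S a).bind (der · k A) =
      bet S (a.bind (der · (k + 1) (A.map (lift 1 · 0)))) + (der S k A).bind (bet · a)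
  | one, a, k, A => by
    have h (p : Pre Kind.term) :
        (zer p 0).bind (der · k A) = (der p (k + 1) (A.map (lift 1 · 0))).bind (zer · 0) := by
      simpa [Multiset.bind_map, zer_lift_self] using
        (bind_zer_der p k 0 (A.map (lift 1 · 0))).symm
    simp [bet, der, Multiset.bind_assoc, h]
  | mul s S, a, k, A => by
    have h (p : Pre Kind.term) : (der p 0 {lift 1 s 0}).bind (der · (k + 1) (A.map (lift 1 · 0))) =
        (der p (k + 1) (A.map (lift 1 · 0))).bind (der · 0 {lift 1 s 0}) +
          (der s k A).bind fun x => der p 0 {lift 1 x 0} := by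
      -- Of the two corrections, the one deriving the lifted `A` along `0` vanishes, and the one
      -- deriving the lifted `s` is the lift of `der s k A`, by `h₂`.
      have h₁ := der_der p 0 (k + 1) (A.map (lift 1 · 0)) {lift 1 s 0}
      have h₂ := map_lift_der s k 0 A
      simp only [Nat.not_lt_zero, if_false] at h₂
      simp only [Multiset.bind_map, der_lift_self, Multiset.bind_zero, der_zero, add_zero,
        Multiset.singleton_bind, ← h₂] at h₁
      rw [h₁]
      congr 1
      rw [← bind_singleton, der_bind]
    simp only [bet, der, bet_bind_der S, Multiset.bind_assoc, h, Multiset.bind_add, bet_add,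
      Multiset.add_bind, Multiset.bind_map, add_assoc, bet_bind, Multiset.bind_bind a (der s k A),
      Multiset.bind_bind a (der S k A)]

theorem bet_bind_zer : ∀ (S : Pre Kind.poly) (a : Multiset (Pre Kind.term)) (k : ℕ),
    (bet S a).bind (zer · k) = (zer S k).bind (bet · (a.bind (zer · (k + 1))))
  | one, a, k => by
    simp [bet, zer, Multiset.bind_assoc, zer_zer]
  | mul s S, a, k => by
    have h (p : Pre Kind.term) : (der p 0 {lift 1 s 0}).bind (zer · (k + 1)) =
        (zer s k).bind fun x => (zer p (k + 1)).bind (der · 0 {lift 1 x 0}) := by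
      have h₁ := bind_zer_der p 0 (k + 1) {lift 1 s 0}
      simp only [Nat.succ_pos, if_true, Multiset.singleton_bind,
        ← map_lift_zer_of_ge s (Nat.zero_le k)] at h₁
      rw [h₁]
      simp only [← bind_singleton, der_bind]
      rw [Multiset.bind_bind]
    simp only [bet, zer, bet_bind_zer S, bind_map₂, Multiset.bind_assoc, h, bet_bind]
    simp only [Multiset.bind_bind (zer s k) (zer S k), Multiset.bind_bind (zer s k) a,
      Multiset.bind_bind a (zer S k)]

/-! ### Parallel reduction -/

/-- Parallel reduction of terms and poly-terms to finite sums. -/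
inductive Par : {κ : Kind} → Pre κ → Multiset (Pre κ) → Prop
  | var (n : ℕ) : Par (var n) {var n}
  | lam {s : Pre Kind.term} {a : Multiset (Pre Kind.term)} : Par s a → Par (lam s) (a.map lam)
  | app {s : Pre Kind.term} {S : Pre Kind.poly} {a : Multiset (Pre Kind.term)}
      {b : Multiset (Pre Kind.poly)} : Par s a → Par S b → Par (app s S) (map₂ app a b)
  | beta {t : Pre Kind.term} {S : Pre Kind.poly} {a : Multiset (Pre Kind.term)}
      {b : Multiset (Pre Kind.poly)} :
      Par t a → Par S b → Par (app (lam t) S) (b.bind (bet · a))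
  | one : Par one {one}
  | mul {s : Pre Kind.term} {S : Pre Kind.poly} {a : Multiset (Pre Kind.term)}
      {b : Multiset (Pre Kind.poly)} : Par s a → Par S b → Par (mul s S) (map₂ mul a b)

/-- The additive extension of parallel reduction. -/
inductive ParM {κ : Kind} : Multiset (Pre κ) → Multiset (Pre κ) → Prop
  | zero : ParM 0 0
  | cons {p : Pre κ} {a b c : Multiset (Pre κ)} : Par p b → ParM a c → ParM (p ::ₘ a) (b + c)

theorem Par.refl {κ : Kind} (p : Pre κ) : Par p {p} := by
  induction p with
  | var n => exact .var n
  | lam s ih => simpa using ih.lam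
  | app s S ih ih' => simpa using ih.app ih'
  | one => exact .one
  | mul s S ih ih' => simpa using ih.mul ih'

theorem Par.parM {κ : Kind} {p : Pre κ} {b : Multiset (Pre κ)} (h : Par p b) : ParM {p} b := by
  simpa using ParM.cons h .zero

namespace ParM

variable {κ κ' κ'' : Kind}

theorem add {a b c d : Multiset (Pre κ)} (h : ParM a b) (h' : ParM c d) :
    ParM (a + c) (b + d) := by
  induction h with
  | zero => simpa using h'
  | cons hp _ ih => simpa [add_assoc] using cons hp ih

theorem refl (a : Multiset (Pre κ)) : ParM a a := by
  induction a using Multiset.induction_on with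
  | empty => exact .zero
  | cons p a ih => simpa using cons (Par.refl p) ih

theorem bind {a b : Multiset (Pre κ)} {f g : Pre κ → Multiset (Pre κ')} (h : ParM a b)
    (hfg : ∀ p c, Par p c → ParM (f p) (c.bind g)) : ParM (a.bind f) (b.bind g) := by
  induction h with
  | zero => simpa using zero
  | cons hp _ ih => simpa using (hfg _ _ hp).add ih

theorem map {a b : Multiset (Pre κ)} {f : Pre κ → Pre κ'} (h : ParM a b)
    (hf : ∀ p c, Par p c → Par (f p) (c.map f)) : ParM (a.map f) (b.map f) := by
  simp only [← bind_singleton]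
  exact h.bind fun p c hp => by simpa only [bind_singleton] using (hf p c hp).parM

/-- `F` is any biadditive operation rather than a `map₂`, so that the contraction `b.bind (bet · a)`
is covered too. -/
theorem bilinear {f : Pre κ → Pre κ' → Pre κ''}
    {F : Multiset (Pre κ) → Multiset (Pre κ') → Multiset (Pre κ'')}
    (zero_left : ∀ c, F 0 c = 0) (zero_right : ∀ a, F a 0 = 0)
    (add_left : ∀ a b c, F (a + b) c = F a c + F b c)
    (add_right : ∀ a b c, F a (b + c) = F a b + F a c)
    (hf : ∀ p b q c, Par p b → Par q c → Par (f p q) (F b c))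
    {a a' : Multiset (Pre κ)} {b b' : Multiset (Pre κ')} (ha : ParM a a') (hb : ParM b b') :
    ParM (map₂ f a b) (F a' b') := by
  induction ha with
  | zero => simpa [zero_left] using zero
  | @cons p _ c _ hp _ ih =>
    rw [← Multiset.singleton_add, map₂_add_left, add_left]
    refine ParM.add ?_ ih
    clear ih
    induction hb with
    | zero => simpa [zero_right] using zero
    | cons hq _ ih =>
      rw [← Multiset.singleton_add, map₂_add_right, add_right]
      exact ParM.add (by simpa using (hf _ _ _ _ hp hq).parM) ih

theorem app {a a' : Multiset (Pre Kind.term)} {b b' : Multiset (Pre Kind.poly)} (ha : ParM a a')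
    (hb : ParM b b') : ParM (map₂ Pre.app a b) (map₂ Pre.app a' b') :=
  bilinear (map₂_zero_left _) (map₂_zero_right _) (map₂_add_left _) (map₂_add_right _)
    (fun _ _ _ _ => Par.app) ha hb

theorem mul {a a' : Multiset (Pre Kind.term)} {b b' : Multiset (Pre Kind.poly)} (ha : ParM a a')
    (hb : ParM b b') : ParM (map₂ Pre.mul a b) (map₂ Pre.mul a' b') :=
  bilinear (map₂_zero_left _) (map₂_zero_right _) (map₂_add_left _) (map₂_add_right _)
    (fun _ _ _ _ => Par.mul) ha hb

theorem beta {a a' : Multiset (Pre Kind.term)} {b b' : Multiset (Pre Kind.poly)} (ha : ParM a a')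
    (hb : ParM b b') : ParM (map₂ Pre.app (a.map Pre.lam) b) (b'.bind (bet · a')) := by
  have h := bilinear (f := fun t S => Pre.app (Pre.lam t) S) (F := fun a b => b.bind (bet · a))
    (by simp [bet_zero]) (by simp) (by simp [bet_add, bind_add]) (by simp)
    (fun _ _ _ _ => Par.beta) ha hb
  simpa [map₂, Multiset.bind_map] using h

end ParM

/-! ### Compatibility of parallel reduction with derivative, erasure and substitution -/

theorem Par.lift {κ : Kind} {p : Pre κ} {b : Multiset (Pre κ)} (h : Par p b) (c : ℕ) :
    Par (lift 1 p c) (b.map (Pre.lift 1 · c)) := by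
  induction h generalizing c with
  | var n => simpa using Par.refl _
  | lam _ ih => simpa [Pre.lift, Function.comp_def] using (ih (c + 1)).lam
  | app _ _ ih ih' => simpa [Pre.lift, map_map₂, map₂_map] using (ih c).app (ih' c)
  | beta _ _ ih ih' =>
    simpa [Pre.lift, Multiset.map_bind, Multiset.bind_map, map_lift_bet] using
      (ih (c + 1)).beta (ih' c)
  | one => simpa using Par.refl _
  | mul _ _ ih ih' => simpa [Pre.lift, map_map₂, map₂_map] using (ih c).mul (ih' c)

theorem Par.der {κ : Kind} {p : Pre κ} {b : Multiset (Pre κ)} (h : Par p b) (k : ℕ)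
    {A A' : Multiset (Pre Kind.term)} (hA : ParM A A') :
    ParM (der p k A) (b.bind (Pre.der · k A')) := by
  induction h generalizing k A A' with
  | var n =>
    simp only [Multiset.singleton_bind, Pre.der]
    split_ifs
    exacts [hA, .zero]
  | lam _ ih =>
    have hA' := hA.map (f := (Pre.lift 1 · 0)) fun _ _ h => h.lift 0
    simpa [Pre.der, Multiset.bind_map, Multiset.map_bind] using
      (ih (k + 1) hA').map fun _ _ => Par.lam
  | app h h' ih ih' =>
    rw [der_app, map₂_app_bind_der]
    exact ((ih k hA).app h'.parM).add (h.parM.app (ih' k hA))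
  | beta h h' ih ih' =>
    have hA' := hA.map (f := (Pre.lift 1 · 0)) fun _ _ h => h.lift 0
    -- By `bet_bind_der` the derivative of the contractum splits, like that of the redex, into a
    -- part in the body and a part in the bag.
    simp only [der_app, Multiset.bind_assoc, bet_bind_der, bind_add]
    refine ParM.add ?_ ?_
    · simpa only [Pre.der] using (ih (k + 1) hA').beta h'.parM
    · simpa [Multiset.bind_assoc] using h.parM.beta (ih' k hA)
  | one => simpa [Pre.der] using ParM.zero
  | mul h h' ih ih' =>
    rw [der_mul, map₂_mul_bind_der]
    exact ((ih k hA).mul h'.parM).add (h.parM.mul (ih' k hA))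

theorem Par.zer {κ : Kind} {p : Pre κ} {b : Multiset (Pre κ)} (h : Par p b) (k : ℕ) :
    ParM (zer p k) (b.bind (Pre.zer · k)) := by
  induction h generalizing k with
  | var n => simpa using ParM.refl _
  | lam _ ih =>
    simpa [Pre.zer, Multiset.bind_map, Multiset.map_bind] using
      (ih (k + 1)).map fun _ _ => Par.lam
  | app _ _ ih ih' =>
    rw [map₂_app_bind_zer]
    exact (ih k).app (ih' k)
  | beta _ _ ih ih' =>
    simpa [Pre.zer, Multiset.bind_assoc, bet_bind_zer] using (ih (k + 1)).beta (ih' k)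
  | one => simpa [Pre.zer] using ParM.refl _
  | mul _ _ ih ih' =>
    rw [map₂_mul_bind_zer]
    exact (ih k).mul (ih' k)

theorem Par.bet : ∀ {S : Pre Kind.poly} {b : Multiset (Pre Kind.poly)}
    {a a' : Multiset (Pre Kind.term)}, Par S b → ParM a a' →
    ParM (bet S a) (b.bind (Pre.bet · a'))
  | Pre.one, _, _, _, .one, ha => by
    simpa [Pre.bet] using ha.bind fun _ _ h => h.zer 0
  | Pre.mul s S, _, a, a', .mul (a := c) (b := d) hs hS, ha => by
    have h₁ : ParM (a.bind (Pre.der · 0 {Pre.lift 1 s 0}))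
        (a'.bind (Pre.der · 0 (c.map (Pre.lift 1 · 0)))) :=
      ha.bind fun _ _ h => h.der 0 (hs.lift 0).parM
    have h₂ := hS.bet h₁
    simp only [Pre.bet, bind_map₂]
    -- The derivative along the sum of reducts of `s` becomes the sum of the derivatives along each
    -- of them, which is how `bet` treats the reduced bags.
    simp only [← bind_singleton, der_bind] at h₂
    simpa only [Multiset.bind_bind a' c, bet_bind, Multiset.bind_bind d c] using h₂

theorem ParM.bet {a a' : Multiset (Pre Kind.term)} {b b' : Multiset (Pre Kind.poly)}
    (ha : ParM a a') (hb : ParM b b') : ParM (b.bind (Pre.bet · a)) (b'.bind (Pre.bet · a')) :=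
  hb.bind fun _ _ h => h.bet ha

/-! ### Complete developments -/

/-- The complete development of a term or poly-term. -/
def dev : {κ : Kind} → Pre κ → Multiset (Pre κ)
  | _, var n => {var n}
  | _, lam s => (dev s).map lam
  | _, app (lam t) S => (dev S).bind (bet · (dev t))
  | _, app s S => map₂ app (dev s) (dev S)
  | _, one => {one}
  | _, mul s S => map₂ mul (dev s) (dev S)

/-- Triangle property: the development contracts all redexes present in `p`, so it remains to
contract those that the given reduction skipped. On a redex, `ParM.beta` serves when it was left and
`ParM.bet` when it was already contracted. -/
theorem Par.dev : ∀ {κ : Kind} {p : Pre κ} {b : Multiset (Pre κ)}, Par p b → ParM b (dev p)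
  | _, Pre.var _, _, .var _ => ParM.refl _
  | _, Pre.lam _, _, .lam h => h.dev.map fun _ _ => Par.lam
  | _, Pre.app (Pre.lam _) _, _, .app (.lam h) h' => h.dev.beta h'.dev
  | _, Pre.app (Pre.lam _) _, _, .beta h h' => h.dev.bet h'.dev
  | _, Pre.app (Pre.var _) _, _, .app h h' => h.dev.app h'.dev
  | _, Pre.app (Pre.app _ _) _, _, .app h h' => h.dev.app h'.dev
  | _, Pre.one, _, .one => ParM.refl _
  | _, Pre.mul _ _, _, .mul h h' => h.dev.mul h'.dev

theorem ParM.dev {κ : Kind} {a b : Multiset (Pre κ)} (h : ParM a b) :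
    ParM b (a.bind Pre.dev) := by
  induction h with
  | zero => simpa using zero
  | cons hp _ ih => simpa using hp.dev.add ih

end Pre

/-! ### Iterated derivatives and the sum over permutations -/

/-- A permutation of `n + 1` letters amounts to the position of `0` and a permutation of `n`
letters. -/
theorem Fin.sum_perm_cons {α M : Type*} [AddCommMonoid M] {n : ℕ} (x : α) (v : Fin n → α)
    (F : (Fin (n + 1) → α) → M) :
    ∑ f : Equiv.Perm (Fin (n + 1)), F (fun i => (Fin.cons x v : Fin (n + 1) → α) (f i)) =
      ∑ e : Equiv.Perm (Fin n), ∑ j : Fin (n + 1),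
        F (j.insertNth (α := fun _ => α) x fun i => v (e i)) := by
  -- `finSuccEquiv' j` singles out the letter `j`, so `Φ (e, j)` sends `j` to `0` and acts as `e` on
  -- the remaining letters. It is injective, and `n! * (n + 1) = (n + 1)!` makes it bijective.
  let Φ : Equiv.Perm (Fin n) × Fin (n + 1) → Equiv.Perm (Fin (n + 1)) := fun q =>
    (finSuccEquiv' q.2).trans ((Equiv.optionCongr q.1).trans (finSuccEquiv' 0).symm)
  have h₀ (e : Equiv.Perm (Fin n)) (j : Fin (n + 1)) : Φ (e, j) j = 0 := by simp [Φ]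
  have h₁ (e : Equiv.Perm (Fin n)) (j : Fin (n + 1)) (i : Fin n) :
      Φ (e, j) (j.succAbove i) = (e i).succ := by simp [Φ]
  have hinj : Function.Injective Φ := by
    rintro ⟨e, j⟩ ⟨e', j'⟩ h
    obtain rfl : j = j' := (Φ (e', j')).injective (by rw [h₀, ← h, h₀])
    congr
    ext i : 1
    exact Fin.succ_injective _ (by rw [← h₁ e j, h, h₁])
  have hbij : Function.Bijective Φ := (Fintype.bijective_iff_injective_and_card Φ).2
    ⟨hinj, by simp [Fintype.card_perm, Nat.factorial_succ, mul_comm]⟩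
  rw [← Fintype.sum_prod_type']
  refine (Fintype.sum_bijective Φ hbij _ _ fun q => ?_).symm
  obtain ⟨e, j⟩ := q
  congr 1
  funext i
  revert i
  rw [Fin.forall_iff_succAbove j]
  simp [h₀, h₁]

theorem Multiset.bind_finsetSum {α β ι : Type*} (a : Multiset α) (I : Finset ι)
    (g : ι → α → Multiset β) :
    (a.bind fun q => ∑ i ∈ I, g i q) = ∑ i ∈ I, a.bind (g i) := by
  induction a using Multiset.induction_on with
  | empty => simp
  | cons x a ih => simp [ih, Finset.sum_add_distrib]

namespace Pre

open Multiset

theorem occ_lift {κ : Kind} (p : Pre κ) {d c k : ℕ} (h : c ≤ k) (h' : k < c + d) :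
    occ (lift d p c) k = 0 := by
  induction p generalizing c k with
  | var n => simp only [lift]; split_ifs <;> simp only [occ] <;> split_ifs <;> first | rfl | omega
  | lam s ih => simpa [lift, occ] using ih (c := c + 1) (k := k + 1) (by omega) (by omega)
  | app s S ih ih' => simp [lift, occ, ih h h', ih' h h']
  | one => rfl
  | mul s S ih ih' => simp [lift, occ, ih h h', ih' h h']

/-- The variable `k` lies in the gap opened by the lifting, so nothing is filled and the gap only
narrows by one. -/
theorem fill_lift {κ : Kind} (p : Pre κ) {d c k : ℕ} (h : c ≤ k) (h' : k ≤ c + d)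
    (u : ℕ → Pre Kind.term) : fill (lift (d + 1) p c) k u = lift d p c := by
  induction p generalizing c k u with
  | var n =>
    simp only [lift]
    split_ifs <;> simp only [fill] <;> split_ifs <;> first | rfl | omega
  | lam s ih => simpa [lift, fill] using ih (c := c + 1) (k := k + 1) (by omega) (by omega) u
  | app s S ih ih' => simp [lift, fill, ih h h', ih' h h']
  | one => rfl
  | mul s S ih ih' => simp [lift, fill, ih h h', ih' h h']

theorem fill_congr {κ : Kind} (p : Pre κ) (k : ℕ) {u u' : ℕ → Pre Kind.term}
    (h : ∀ i < occ p k, u i = u' i) : fill p k u = fill p k u' := by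
  induction p generalizing k u u' with
  | var n =>
    simp only [fill]
    split_ifs with h₁ h₂
    · rfl
    · rw [h 0 (by simp [occ, h₂])]
    · rfl
  | lam s ih => simp only [fill]; rw [ih (k + 1) h]
  | app s S ih ih' =>
    simp only [occ] at h
    simp only [fill]
    rw [ih k fun i hi => h i (by omega), ih' k fun i hi => h _ (by omega)]
  | one => rfl
  | mul s S ih ih' =>
    simp only [occ] at h
    simp only [fill]
    rw [ih k fun i hi => h i (by omega), ih' k fun i hi => h _ (by omega)]

theorem zer_eq_fill {κ : Kind} (p : Pre κ) (k : ℕ) (u : ℕ → Pre Kind.term) :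
    zer p k = if occ p k = 0 then {fill p k u} else 0 := by
  induction p generalizing k u with
  | var n =>
    rcases lt_trichotomy n k with h | h | h
    · simp [zer, occ, fill, h, h.ne]
    · simp [zer, occ, h]
    · simp [zer, occ, fill, h.ne', h.not_gt]
  | lam s ih =>
    by_cases h : occ s (k + 1) = 0 <;> simp [zer, occ, fill, ih (k + 1) u, h]
  | app s S ih ih' =>
    simp only [zer, occ, fill, ih k u, ih' k fun i => u (occ s k + i)]
    split_ifs <;> simp <;> omega
  | one => simp [zer, occ, fill]
  | mul s S ih ih' =>
    simp only [zer, occ, fill, ih k u, ih' k fun i => u (occ s k + i)]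
    split_ifs <;> simp <;> omega

/-- Insertion of the term `v` at position `j` in a sequence of terms. -/
def insertAt (j : ℕ) (v : Pre Kind.term) (u : ℕ → Pre Kind.term) (i : ℕ) : Pre Kind.term :=
  if i < j then u i else if i = j then v else u (i - 1)

theorem map_lift_singleton (v : Pre Kind.term) (k : ℕ) :
    ({lift (k + 1) v 0} : Multiset (Pre Kind.term)).map (lift 1 · 0) = {lift (k + 1 + 1) v 0} := by
  simp [lift_one_lift]

/-- The inserted term is lifted past `k`, hence brings no new occurrence of `k`, while one old
occurrence disappears. -/
theorem occ_of_mem_der {κ : Kind} (p : Pre κ) (k : ℕ) (v : Pre Kind.term) {q : Pre κ}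
    (h : q ∈ der p k {lift (k + 1) v 0}) : occ q k + 1 = occ p k := by
  induction p generalizing k with
  | var n =>
    simp only [der] at h
    split_ifs at h with hn
    · rw [Multiset.mem_singleton.1 h, occ_lift v (Nat.zero_le k) (by omega)]
      simp [occ, hn]
    · simp at h
  | lam s ih =>
    simp only [der, map_lift_singleton, Multiset.mem_map] at h
    obtain ⟨q', h, rfl⟩ := h
    simpa [occ] using ih (k + 1) h
  | app s S ih ih' =>
    simp only [der, Multiset.mem_add, Multiset.mem_map] at h
    obtain ⟨q', h, rfl⟩ | ⟨q', h, rfl⟩ := h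
    · have := ih k h; simp only [occ]; omega
    · have := ih' k h; simp only [occ]; omega
  | one => simp [der] at h
  | mul s S ih ih' =>
    simp only [der, Multiset.mem_add, Multiset.mem_map] at h
    obtain ⟨q', h, rfl⟩ | ⟨q', h, rfl⟩ := h
    · have := ih k h; simp only [occ]; omega
    · have := ih' k h; simp only [occ]; omega

/-- Common induction step for `app` and `mul`: the occurrences in the node are those of `s` followed
by those of `S`, and the position `j` of the derivative falls in one of these two blocks. -/
theorem map_fill_der_node {κ κ' κ'' : Kind} {f : Pre κ → Pre κ' → Pre κ''} (s : Pre κ)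
    (S : Pre κ') (k : ℕ) (v : Pre Kind.term) (u : ℕ → Pre Kind.term)
    (hf : ∀ s S u, fill (f s S) k u = f (fill s k u) (fill S k fun i => u (occ s k + i)))
    (ih : ∀ u, (der s k {lift (k + 1) v 0}).map (fill · k u) =
      (range (occ s k)).map fun j => fill s k (insertAt j v u))
    (ih' : ∀ u, (der S k {lift (k + 1) v 0}).map (fill · k u) =
      (range (occ S k)).map fun j => fill S k (insertAt j v u)) :
    ((der s k {lift (k + 1) v 0}).map (f · S) + (der S k {lift (k + 1) v 0}).map (f s)).map
        (fill · k u) =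
      (range (occ s k + occ S k)).map fun j => fill (f s S) k (insertAt j v u) := by
  rw [range_add, Multiset.map_add, Multiset.map_add]
  simp only [Multiset.map_map, Function.comp_def, hf]
  congr 1
  -- One occurrence in `s` is already used, so the numbering in `S` starts one earlier; the
  -- truncated subtraction is harmless because a summand exists only if `s` has an occurrence.
  · calc _ = ((der s k {lift (k + 1) v 0}).map (fill · k u)).map
          (f · (fill S k fun i => u (occ s k - 1 + i))) := by
          rw [Multiset.map_map]
          refine map_congr rfl fun q hq => ?_
          simp [← occ_of_mem_der s k v hq]
      _ = _ := by
          rw [ih, Multiset.map_map]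
          refine map_congr rfl fun j hj => ?_
          rw [Multiset.mem_range] at hj
          simp only [Function.comp_def]
          congr 1
          refine fill_congr _ _ fun i _ => ?_
          rw [insertAt, if_neg (by omega), if_neg (by omega)]
          congr 1
          omega
  · calc _ = ((der S k {lift (k + 1) v 0}).map (fill · k fun i => u (occ s k + i))).map
          (f (fill s k u)) := by
          rw [Multiset.map_map]
          rfl
      _ = _ := by
          rw [ih', Multiset.map_map]
          refine map_congr rfl fun j hj => ?_
          simp only [Function.comp_def]
          congr 1
          · refine fill_congr _ _ fun i hi => ?_
            rw [insertAt, if_pos (by omega)]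
          · refine fill_congr _ _ fun i _ => ?_
            simp only [insertAt]
            split_ifs <;> first | rfl | omega | (congr 1; omega)

/-- Deriving along `v` selects the occurrence that receives `v`; filling the others from `u` amounts
to filling all of them from `u` with `v` inserted at that position. -/
theorem map_fill_der {κ : Kind} (p : Pre κ) (k : ℕ) (v : Pre Kind.term)
    (u : ℕ → Pre Kind.term) : (der p k {lift (k + 1) v 0}).map (fill · k u) =
      (range (occ p k)).map fun j => fill p k (insertAt j v u) := by
  induction p generalizing k u with
  | var n =>
    simp only [der, occ]
    split_ifs with hn
    · simp [fill, hn, insertAt, fill_lift v (Nat.zero_le k) (by omega : k ≤ 0 + k)]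
    · simp
  | lam s ih =>
    have h := congrArg (Multiset.map lam) (ih (k + 1) u)
    simpa only [der, occ, map_lift_singleton, Multiset.map_map, Function.comp_def, fill] using h
  | app s S ih ih' => exact map_fill_der_node s S k v u (fun _ _ _ => rfl) (ih k) (ih' k)
  | one => simp [der, occ]
  | mul s S ih ih' => exact map_fill_der_node s S k v u (fun _ _ _ => rfl) (ih k) (ih' k)

/-- The extension of a finite sequence of terms by a dummy value. -/
def extend {n : ℕ} (w : Fin n → Pre Kind.term) (i : ℕ) : Pre Kind.term :=
  if h : i < n then w ⟨i, h⟩ else var 0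

theorem extend_insertNth {n : ℕ} (j : Fin (n + 1)) (v : Pre Kind.term)
    (w : Fin n → Pre Kind.term) :
    extend (j.insertNth (α := fun _ => Pre Kind.term) v w) = insertAt j v (extend w) := by
  funext i
  by_cases hi : i < n + 1
  · rw [extend, dif_pos hi]
    generalize hi' : (⟨i, hi⟩ : Fin (n + 1)) = i'
    obtain rfl : i = i' := by rw [← hi']
    clear hi hi'
    revert i'
    rw [Fin.forall_iff_succAbove j]
    refine ⟨by simp [insertAt], fun i => ?_⟩
    rw [Fin.insertNth_apply_succAbove, insertAt]
    rcases lt_or_ge i.castSucc j with h | h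
    · rw [Fin.succAbove_of_castSucc_lt _ _ h, if_pos (Fin.lt_def.1 h)]
      simp [extend]
    · have h' : (j : ℕ) ≤ i := h
      rw [Fin.succAbove_of_le_castSucc _ _ h]
      simp only [Fin.val_succ]
      rw [if_neg (by omega), if_neg (by omega)]
      simp [extend]
  · rw [extend, dif_neg hi, insertAt, if_neg (by omega), if_neg (by omega), extend,
      dif_neg (by omega)]

/-- Differential substitution of a list of terms. -/
def lsubst (t : Pre Kind.term) (l : List (Pre Kind.term)) : Multiset (Pre Kind.term) :=
  if t.occ 0 = l.length then
    ∑ f : Equiv.Perm (Fin l.length), {t.fill 0 (extend fun i => l.get (f i))}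
  else 0

theorem msubst_eq_lsubst (t : Pre Kind.term) (S : Pre Kind.poly) :
    msubst t S = lsubst t S.toList := rfl

/-- Induction on the bag: the derivative along the first factor chooses its position, the remaining
factors give a permutation of one letter less, and `Fin.sum_perm_cons` reassembles the two. When the
number of occurrences is wrong, it stays wrong after one derivative, so both sides vanish. -/
theorem bet_singleton : ∀ (S : Pre Kind.poly) (t : Pre Kind.term), bet S {t} = msubst t S
  | one, t => by
    rw [msubst_eq_lsubst, toList, lsubst, bet, Multiset.singleton_bind,
      zer_eq_fill t 0 (extend fun i => ([] : List _).get i)]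
    simp
  | mul s S, t => by
    have h₁ : bet (mul s S) {t} = (der t 0 {lift 1 s 0}).bind fun q => lsubst q S.toList := by
      simp only [bet, Multiset.singleton_bind, ← msubst_eq_lsubst, ← bet_singleton S, ← bet_bind,
        bind_singleton_self]
    rw [h₁, msubst_eq_lsubst, toList]
    generalize S.toList = l
    have h₃ : (s :: l).get = (Fin.cons s l.get : Fin (l.length + 1) → Pre Kind.term) := by
      funext i
      cases i using Fin.cases <;> rfl
    rw [lsubst, h₃]
    simp only [List.length_cons]
    split_ifs with h
    · rw [Fin.sum_perm_cons s l.get fun w => ({t.fill 0 (extend w)} : Multiset _)]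
      calc _ = (der t 0 {lift 1 s 0}).bind fun q =>
              ∑ f : Equiv.Perm (Fin l.length),
                {q.fill 0 (extend fun i => l.get (f i))} := by
            refine bind_congr fun q hq => ?_
            have := occ_of_mem_der t 0 s hq
            exact if_pos (by omega)
        _ = _ := by
            rw [bind_finsetSum]
            refine Finset.sum_congr rfl fun f _ => ?_
            simp only [extend_insertNth]
            rw [bind_singleton, map_fill_der t 0 s, h, ← Finset.sum_range fun j =>
              ({t.fill 0 (insertAt j s (extend fun i => l.get (f i)))} : Multiset _)]
            exact (bind_singleton _ _).symm
    · rw [← Multiset.bind_zero (der t 0 {lift 1 s 0})]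
      refine bind_congr fun q hq => ?_
      have := occ_of_mem_der t 0 s hq
      exact if_neg (by omega)

/-! ### Comparison of parallel and one-step reduction -/

theorem Step.par {κ : Kind} {p : Pre κ} {m : Multiset (Pre κ)} (h : Step p m) : Par p m := by
  induction h with
  | lam _ ih => exact ih.lam
  | fn S _ ih => simpa using ih.app (Par.refl S)
  | arg s _ ih => simpa using (Par.refl s).app ih
  | beta t S => simpa [bet_singleton] using (Par.refl t).beta (Par.refl S)
  | head S _ ih => simpa using ih.mul (Par.refl S)
  | tail s _ ih => simpa using (Par.refl s).mul ih

theorem Par.eq_of_forall_not_step {κ : Kind} {p : Pre κ} {b : Multiset (Pre κ)} (h : Par p b)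
    (hp : ∀ m, ¬ Step p m) : b = {p} := by
  induction h with
  | var n => rfl
  | lam _ ih => simp [ih fun m h => hp _ h.lam]
  | app _ _ ih ih' => simp [ih fun m h => hp _ (h.fn _), ih' fun m h => hp _ (h.arg _)]
  | beta _ _ => exact absurd (Step.beta _ _) (hp _)
  | one => rfl
  | mul _ _ ih ih' => simp [ih fun m h => hp _ (h.head _), ih' fun m h => hp _ (h.tail _)]

/-! ### Size -/

/-- The number of variables, abstractions and applications. -/
def size : {κ : Kind} → Pre κ → ℕ
  | _, var _ => 1
  | _, lam s => size s + 1
  | _, app s S => size s + size S + 1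
  | _, one => 0
  | _, mul s S => size s + size S

theorem size_lift {κ : Kind} (p : Pre κ) (d c : ℕ) : size (lift d p c) = size p := by
  induction p generalizing c with
  | var n => simp only [lift]; split_ifs <;> rfl
  | lam s ih => simp [lift, size, ih]
  | app s S ih ih' => simp [lift, size, ih, ih']
  | one => rfl
  | mul s S ih ih' => simp [lift, size, ih, ih']

theorem size_le_of_mem_der {κ : Kind} (p : Pre κ) (k : ℕ) {n : ℕ}
    {A : Multiset (Pre Kind.term)} (hA : ∀ x ∈ A, size x ≤ n) {q : Pre κ} (h : q ∈ der p k A) :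
    size q ≤ size p + n := by
  induction p generalizing k A with
  | var m =>
    simp only [der] at h
    split_ifs at h
    · exact (hA q h).trans (Nat.le_add_left _ _)
    · simp at h
  | lam s ih =>
    simp only [der, Multiset.mem_map] at h
    obtain ⟨q', h, rfl⟩ := h
    have := ih (k + 1) (by simpa [size_lift] using hA) h
    simp only [size]; omega
  | app s S ih ih' =>
    simp only [der, Multiset.mem_add, Multiset.mem_map] at h
    obtain ⟨q', h, rfl⟩ | ⟨q', h, rfl⟩ := h
    · have := ih k hA h; simp only [size]; omega
    · have := ih' k hA h; simp only [size]; omega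
  | one => simp [der] at h
  | mul s S ih ih' =>
    simp only [der, Multiset.mem_add, Multiset.mem_map] at h
    obtain ⟨q', h, rfl⟩ | ⟨q', h, rfl⟩ := h
    · have := ih k hA h; simp only [size]; omega
    · have := ih' k hA h; simp only [size]; omega

theorem size_of_mem_zer {κ : Kind} (p : Pre κ) (k : ℕ) {q : Pre κ} (h : q ∈ zer p k) :
    size q = size p := by
  induction p generalizing k with
  | var m =>
    simp only [zer] at h
    split_ifs at h <;> simp_all [size]
  | lam s ih =>
    simp only [zer, Multiset.mem_map] at h
    obtain ⟨q', h, rfl⟩ := h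
    simp [size, ih _ h]
  | app s S ih ih' =>
    simp only [zer, map₂, Multiset.mem_bind, Multiset.mem_map] at h
    obtain ⟨x, hx, y, hy, rfl⟩ := h
    simp [size, ih _ hx, ih' _ hy]
  | one => rw [Multiset.mem_singleton.1 h]
  | mul s S ih ih' =>
    simp only [zer, map₂, Multiset.mem_bind, Multiset.mem_map] at h
    obtain ⟨x, hx, y, hy, rfl⟩ := h
    simp [size, ih _ hx, ih' _ hy]

theorem size_le_of_mem_bet : ∀ (S : Pre Kind.poly) {a : Multiset (Pre Kind.term)} {n : ℕ},
    (∀ t ∈ a, size t ≤ n) → ∀ {q : Pre Kind.term}, q ∈ bet S a → size q ≤ n + size S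
  | one, a, n, ha, q, h => by
    simp only [bet, Multiset.mem_bind] at h
    obtain ⟨t, ht, h⟩ := h
    rw [size_of_mem_zer t 0 h]
    exact ha t ht
  | mul s S, a, n, ha, q, h => by
    simp only [bet] at h
    have := size_le_of_mem_bet S (a := a.bind (der · 0 {lift 1 s 0})) (n := n + size s)
      (fun t ht => by
      obtain ⟨x, hx, ht⟩ := Multiset.mem_bind.1 ht
      have := size_le_of_mem_der (n := size s) x 0 (by simp [size_lift]) ht
      have := ha x hx
      omega) h
    simp only [size]; omega

/-- The bound on `bet` ignores the variables that are replaced; the abstraction and the application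
that a contraction destroys suffice for strictness. -/
theorem Step.size_lt {κ : Kind} {p : Pre κ} {m : Multiset (Pre κ)} (h : Step p m) :
    ∀ q ∈ m, size q < size p := by
  induction h with
  | lam _ ih => simpa [size] using ih
  | fn S _ ih => simpa [size] using ih
  | arg s _ ih => simpa [size] using ih
  | beta t S =>
    intro q hq
    rw [← bet_singleton] at hq
    have := size_le_of_mem_bet S (n := size t) (by simp) hq
    simp only [size]; omega
  | head S _ ih => simpa [size] using ih
  | tail s _ ih => simpa [size] using ih

theorem Equiv.size_eq {κ : Kind} {p q : Pre κ} (h : Equiv p q) : size p = size q := by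
  induction h with
  | refl _ => rfl
  | symm _ ih => exact ih.symm
  | trans _ _ ih ih' => exact ih.trans ih'
  | lam _ ih => simp [size, ih]
  | app _ _ ih ih' => simp [size, ih, ih']
  | mul _ _ ih ih' => simp [size, ih, ih']
  | swap s t S => simp only [size]; omega

end Pre

namespace Pre

open Multiset

/-! ### Compatibility with the commutativity of poly-terms -/

/-- Equality of finite sums up to `Pre.Equiv`. -/
def MEquiv {κ : Kind} (a b : Multiset (Pre κ)) : Prop := Multiset.Rel Equiv a b

namespace MEquiv

variable {κ κ' κ'' : Kind} {a b c d : Multiset (Pre κ)}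

theorem refl (a : Multiset (Pre κ)) : MEquiv a a := rel_refl_of_refl_on fun p _ => .refl p

theorem symm (h : MEquiv a b) : MEquiv b a :=
  (rel_flip.2 h).mono fun _ _ _ _ h => Equiv.symm h

theorem trans (h : MEquiv a b) (h' : MEquiv b c) : MEquiv a c :=
  haveI : IsTrans (Pre κ) Equiv := ⟨fun _ _ _ => Equiv.trans⟩
  Multiset.Rel.trans Equiv h h'

theorem add (h : MEquiv a b) (h' : MEquiv c d) : MEquiv (a + c) (b + d) := Multiset.Rel.add h h'

theorem singleton {p q : Pre κ} (h : Equiv p q) : MEquiv {p} {q} := Multiset.Rel.cons h .zero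

theorem bind {f g : Pre κ → Multiset (Pre κ')} (h : MEquiv a b)
    (hfg : ∀ p q, Equiv p q → MEquiv (f p) (g q)) : MEquiv (a.bind f) (b.bind g) :=
  rel_bind hfg h

theorem map {f g : Pre κ → Pre κ'} (h : MEquiv a b)
    (hfg : ∀ p q, Equiv p q → Equiv (f p) (g q)) : MEquiv (a.map f) (b.map g) :=
  rel_map.2 (h.mono fun _ _ _ _ => hfg _ _)

theorem map₂ {f g : Pre κ → Pre κ' → Pre κ''} {a' b' : Multiset (Pre κ')} (h : MEquiv a b)
    (h' : MEquiv a' b') (hfg : ∀ p q, Equiv p q → ∀ p' q', Equiv p' q' → Equiv (f p p') (g q q')) :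
    MEquiv (map₂ f a a') (map₂ g b b') :=
  h.bind fun p q h => h'.map (hfg p q h)

theorem map_mk {a b : Multiset (Pre Kind.term)} (h : MEquiv a b) :
    a.map STerm.mk = b.map STerm.mk := by
  rw [← rel_eq, rel_map]
  exact h.mono fun _ _ _ _ h => Quotient.sound h

end MEquiv

theorem Equiv.lift {κ : Kind} {p q : Pre κ} (h : Equiv p q) (d c : ℕ) :
    Equiv (lift d p c) (lift d q c) := by
  induction h generalizing c with
  | refl _ => exact .refl _
  | symm _ ih => exact (ih c).symm
  | trans _ _ ih ih' => exact (ih c).trans (ih' c)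
  | lam _ ih => exact (ih (c + 1)).lam
  | app _ _ ih ih' => exact (ih c).app (ih' c)
  | mul _ _ ih ih' => exact (ih c).mul (ih' c)
  | swap s t S => exact .swap _ _ _

theorem MEquiv.der_right {κ : Kind} (p : Pre κ) (k : ℕ) {A B : Multiset (Pre Kind.term)}
    (h : MEquiv A B) : MEquiv (der p k A) (der p k B) := by
  induction p generalizing k A B with
  | var n =>
    simp only [der]
    split_ifs
    exacts [h, .refl _]
  | lam s ih => exact (ih (k + 1) (h.map fun _ _ h => h.lift 1 0)).map fun _ _ => Equiv.lam
  | app s S ih ih' =>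
    exact ((ih k h).map fun _ _ h => h.app (.refl S)).add
      ((ih' k h).map fun _ _ h => (Equiv.refl s).app h)
  | one => exact .refl _
  | mul s S ih ih' =>
    exact ((ih k h).map fun _ _ h => h.mul (.refl S)).add
      ((ih' k h).map fun _ _ h => (Equiv.refl s).mul h)

theorem Equiv.der_left {κ : Kind} {p q : Pre κ} (h : Equiv p q) (k : ℕ)
    (A : Multiset (Pre Kind.term)) : MEquiv (der p k A) (der q k A) := by
  induction h generalizing k A with
  | refl _ => exact .refl _
  | symm _ ih => exact (ih k A).symm
  | trans _ _ ih ih' => exact (ih k A).trans (ih' k A)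
  | lam _ ih => exact (ih _ _).map fun _ _ => Equiv.lam
  | app h h' ih ih' =>
    exact ((ih k A).map fun _ _ hs => hs.app h').add ((ih' k A).map fun _ _ hS => h.app hS)
  | mul h h' ih ih' =>
    exact ((ih k A).map fun _ _ hs => hs.mul h').add ((ih' k A).map fun _ _ hS => h.mul hS)
  | swap s t S =>
    simp only [der, Multiset.map_add, Multiset.map_map, Function.comp_def]
    -- The summands deriving `s` and `t` occur in opposite orders on the two sides.
    rw [add_left_comm]
    exact ((MEquiv.refl _).map fun p q h => ((Equiv.refl s).mul (h.mul (.refl S))).trans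
        (.swap _ _ _)).add
      (((MEquiv.refl _).map fun p q h => (h.mul (.refl _)).trans (.swap _ _ _)).add
        ((MEquiv.refl _).map fun p q h => ((Equiv.refl s).mul ((Equiv.refl t).mul h)).trans
          (.swap _ _ _)))

theorem Equiv.der {κ : Kind} {p q : Pre κ} (h : Equiv p q) (k : ℕ)
    {A B : Multiset (Pre Kind.term)} (hA : MEquiv A B) : MEquiv (der p k A) (der q k B) :=
  (h.der_left k A).trans (hA.der_right q k)

theorem map₂_mul_comm (a b : Multiset (Pre Kind.term)) (c : Multiset (Pre Kind.poly)) :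
    MEquiv (map₂ mul a (map₂ mul b c)) (map₂ mul b (map₂ mul a c)) := by
  have h : map₂ mul b (map₂ mul a c) =
      a.bind fun x => b.bind fun y => c.map fun S => mul y (mul x S) := by
    simp only [Multiset.map₂, Multiset.map_bind, Multiset.map_map, Function.comp_def]
    exact bind_bind b a
  rw [h]
  simp only [Multiset.map₂, Multiset.map_bind, Multiset.map_map, Function.comp_def]
  exact (MEquiv.refl a).bind fun s s' h => (MEquiv.refl b).bind fun t t' h' =>
    (MEquiv.refl c).map fun S S' h'' => (h.mul (h'.mul h'')).trans (.swap _ _ _)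

theorem Equiv.zer {κ : Kind} {p q : Pre κ} (h : Equiv p q) (k : ℕ) :
    MEquiv (zer p k) (zer q k) := by
  induction h generalizing k with
  | refl _ => exact .refl _
  | symm _ ih => exact (ih k).symm
  | trans _ _ ih ih' => exact (ih k).trans (ih' k)
  | lam _ ih => exact (ih _).map fun _ _ => Equiv.lam
  | app _ _ ih ih' => exact (ih k).map₂ (ih' k) fun _ _ h _ _ h' => h.app h'
  | mul _ _ ih ih' => exact (ih k).map₂ (ih' k) fun _ _ h _ _ h' => h.mul h'
  | swap s t S => exact map₂_mul_comm _ _ _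

theorem MEquiv.bet_right : ∀ (S : Pre Kind.poly) {a b : Multiset (Pre Kind.term)},
    MEquiv a b → MEquiv (bet S a) (bet S b)
  | one, _, _, h => by simpa only [bet] using h.bind fun _ _ h => h.zer 0
  | mul s S, _, _, h => by
    simpa only [bet] using bet_right S (h.bind fun _ _ h => h.der 0 (.refl {Pre.lift 1 s 0}))

/-- Derivatives along terms that do not depend on the variable commute. -/
theorem bet_mul_mul (s t : Pre Kind.term) (S : Pre Kind.poly) (a : Multiset (Pre Kind.term)) :
    bet (mul s (mul t S)) a = bet (mul t (mul s S)) a := by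
  have h (p : Pre Kind.term) : (der p 0 {lift 1 s 0}).bind (der · 0 {lift 1 t 0}) =
      (der p 0 {lift 1 t 0}).bind (der · 0 {lift 1 s 0}) := by
    simpa [der_lift_self, der_zero] using der_der p 0 0 {lift 1 t 0} {lift 1 s 0}
  simp only [bet, Multiset.bind_assoc, h]

/-- The sort is kept variable, with a cast along `hκ`, so that induction on the equivalence is
possible. -/
theorem Equiv.bet_left {κ : Kind} {p q : Pre κ} (h : Equiv p q) (hκ : κ = Kind.poly)
    (a : Multiset (Pre Kind.term)) : MEquiv (bet (hκ ▸ p) a) (bet (hκ ▸ q) a) := by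
  induction h generalizing a with
  | refl _ => exact .refl _
  | symm _ ih => exact (ih hκ a).symm
  | trans _ _ ih ih' => exact (ih hκ a).trans (ih' hκ a)
  | lam _ _ => cases hκ
  | app _ _ _ _ => cases hκ
  | @mul s t S T h _ _ ih' =>
    simp only [bet]
    exact (MEquiv.bet_right S ((MEquiv.refl a).bind fun _ _ hp =>
      hp.der 0 (.singleton (h.lift 1 0)))).trans (ih' rfl _)
  | swap s t S =>
    rw [bet_mul_mul]
    exact .refl _

theorem Equiv.bet {S T : Pre Kind.poly} (h : Equiv S T) {a b : Multiset (Pre Kind.term)}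
    (hab : MEquiv a b) : MEquiv (bet S a) (bet T b) :=
  (h.bet_left rfl a).trans (hab.bet_right T)

/-- The body of an abstraction. -/
def body : {κ : Kind} → Pre κ → Option (Pre Kind.term)
  | _, lam s => some s
  | _, _ => none

/-- `dev` tests whether the function of an application is an abstraction. Transitivity prevents
inversion of `Equiv` by cases; stating both directions lets the induction pass through symmetry. -/
theorem Equiv.body {κ : Kind} {p q : Pre κ} (h : Equiv p q) :
    (∀ s, body p = some s → ∃ t, body q = some t ∧ Equiv s t) ∧
      ∀ t, body q = some t → ∃ s, body p = some s ∧ Equiv t s := by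
  induction h with
  | refl p => exact ⟨fun s h => ⟨s, h, .refl s⟩, fun s h => ⟨s, h, .refl s⟩⟩
  | symm _ ih => exact ih.symm
  | trans _ _ ih ih' =>
    constructor
    · intro s hs
      obtain ⟨t, ht, h⟩ := ih.1 s hs
      obtain ⟨u, hu, h'⟩ := ih'.1 t ht
      exact ⟨u, hu, h.trans h'⟩
    · intro s hs
      obtain ⟨t, ht, h⟩ := ih'.2 s hs
      obtain ⟨u, hu, h'⟩ := ih.2 t ht
      exact ⟨u, hu, h.trans h'⟩
  | lam h _ => simpa [Pre.body] using ⟨h, h.symm⟩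
  | app _ _ _ _ => simp [Pre.body]
  | mul _ _ _ _ => simp [Pre.body]
  | swap s t S => simp [Pre.body]

theorem Equiv.of_lam {s t : Pre Kind.term} (h : Equiv (Pre.lam s) (Pre.lam t)) : Equiv s t := by
  obtain ⟨u, hu, hs⟩ := h.body.1 s rfl
  cases hu
  exact hs

theorem dev_app_of_body_eq_none {s : Pre Kind.term} (h : body s = none) (S : Pre Kind.poly) :
    dev (app s S) = map₂ app (dev s) (dev S) := by
  cases s with
  | var n => simp [dev]
  | lam s => simp [body] at h
  | app s T => simp [dev]

theorem Equiv.dev {κ : Kind} {p q : Pre κ} (h : Equiv p q) : MEquiv (dev p) (dev q) := by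
  induction h with
  | refl _ => exact .refl _
  | symm _ ih => exact ih.symm
  | trans _ _ ih ih' => exact ih.trans ih'
  | lam _ ih => simpa only [Pre.dev] using ih.map fun _ _ => Equiv.lam
  | @app s t S T h _ ih ih' =>
    rcases hs : Pre.body s with _ | s'
    · have ht : Pre.body t = none := Option.eq_none_iff_forall_ne_some.2 fun u hu => by
        obtain ⟨v, hv, -⟩ := h.body.2 u hu
        simp [hs] at hv
      rw [dev_app_of_body_eq_none hs, dev_app_of_body_eq_none ht]
      exact ih.map₂ ih' fun _ _ h _ _ h' => h.app h'
    · obtain ⟨t', ht, -⟩ := h.body.1 s' hs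
      obtain rfl : s = .lam s' := by cases s <;> simp_all [Pre.body]
      obtain rfl : t = .lam t' := by cases t <;> simp_all [Pre.body]
      simp only [Pre.dev] at ih ⊢
      -- The induction hypothesis concerns the sums under the abstraction, which is stripped summand
      -- by summand.
      have ih₁ : MEquiv (Pre.dev s') (Pre.dev t') :=
        (rel_map.1 ih).mono fun _ _ _ _ => Equiv.of_lam
      exact ih'.bind fun _ _ h => h.bet ih₁
  | mul _ _ ih ih' =>
    simp only [Pre.dev]
    exact ih.map₂ ih' fun _ _ h _ _ h' => h.mul h'
  | swap s t S =>
    simp only [Pre.dev]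
    exact map₂_mul_comm _ _ _

end Pre

open Multiset

/-! ### Confluence and normalization -/

namespace STerm

/-- The complete development of a simple term. -/
def dev : STerm → Multiset STerm :=
  Quotient.lift (fun p => (Pre.dev p).map mk) fun _ _ h => (Pre.Equiv.dev h).map_mk

theorem dev_mk (p : Pre Kind.term) : dev (mk p) = (Pre.dev p).map mk := rfl

/-- The number of variables, abstractions and applications of a simple term. -/
def size : STerm → ℕ := Quotient.lift Pre.size fun _ _ h => Pre.Equiv.size_eq h

theorem Step.size_lt {s : STerm} {b : Multiset STerm} (h : s.Step b) :
    ∀ t ∈ b, size t < size s := by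
  obtain ⟨p, m, rfl, h, rfl⟩ := h
  intro t ht
  obtain ⟨q, hq, rfl⟩ := Multiset.mem_map.1 ht
  exact h.size_lt q hq

end STerm

/-- Parallel reduction of finite sums of simple terms. -/
def ParRed (x y : Multiset STerm) : Prop :=
  ∃ a b, a.map STerm.mk = x ∧ Pre.ParM a b ∧ b.map STerm.mk = y

namespace ParRed

theorem add {x y z w : Multiset STerm} (h : ParRed x y) (h' : ParRed z w) :
    ParRed (x + z) (y + w) := by
  obtain ⟨a, b, rfl, h, rfl⟩ := h
  obtain ⟨c, d, rfl, h', rfl⟩ := h'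
  exact ⟨a + c, b + d, by simp, h.add h', by simp⟩

theorem refl (x : Multiset STerm) : ParRed x x := by
  obtain ⟨a, rfl⟩ := Multiset.exists_multiset_eq_map_quot_mk x
  exact ⟨a, a, rfl, .refl a, rfl⟩

theorem of_step {s : STerm} {b : Multiset STerm} (h : s.Step b) : ParRed {s} b := by
  obtain ⟨p, m, rfl, h, rfl⟩ := h
  exact ⟨{p}, m, by simp, h.par.parM, rfl⟩

theorem of_red01 {x y : Multiset STerm} (h : Red01 x y) : ParRed x y := by
  obtain ⟨l, hl, rfl, rfl⟩ := h
  induction l with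
  | nil => exact refl 0
  | cons q l ih =>
    have hq : ParRed {q.1} q.2 := by
      rcases hl q (by simp) with h | h
      · rw [h]
        exact refl _
      · exact of_step h
    simpa using hq.add (ih fun q hq => hl q (by simp [hq]))

theorem dev {x y : Multiset STerm} (h : ParRed x y) : ParRed y (x.bind STerm.dev) := by
  obtain ⟨a, b, rfl, h, rfl⟩ := h
  exact ⟨b, a.bind Pre.dev, rfl, h.dev, by simp [Multiset.map_bind, Multiset.bind_map,
    STerm.dev_mk]⟩

theorem eq_of_normal {x y : Multiset STerm} (h : ParRed x y) (hx : ∀ t ∈ x, t.Normal) :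
    y = x := by
  obtain ⟨a, b, rfl, h, rfl⟩ := h
  induction h with
  | zero => rfl
  | @cons p a b c hp _ ih =>
    have hb : b = {p} := hp.eq_of_forall_not_step fun m hm =>
      hx (STerm.mk p) (by simp) _ ⟨p, m, rfl, hm, rfl⟩
    have ih := ih fun t ht => hx t (by rw [Multiset.map_cons]; exact Multiset.mem_cons_of_mem ht)
    simp [hb, ih]

end ParRed

theorem Red.exists_parRed_iterate {x y : Multiset STerm} (h : Red x y) :
    ∃ k, Relation.ReflTransGen ParRed y ((fun z => z.bind STerm.dev)^[k] x) := by
  induction h with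
  | single h => exact ⟨1, .single (ParRed.of_red01 h).dev⟩
  | tail _ h ih =>
    obtain ⟨k, hk⟩ := ih
    refine ⟨k + 1, .head (ParRed.of_red01 h).dev ?_⟩
    rw [Function.iterate_succ_apply']
    -- Development is monotone by two uses of the triangle: if `u` reduces to `v`, then `v` reduces
    -- to the development of `u`, which therefore reduces to that of `v`.
    exact hk.lift (fun z => z.bind STerm.dev) fun _ _ h => h.dev.dev

theorem Red.exists_iterate_dev_eq {x c : Multiset STerm} (h : Red x c) (hc : ∀ t ∈ c, t.Normal) :
    ∃ k, (fun z => z.bind STerm.dev)^[k] x = c := by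
  obtain ⟨k, hk⟩ := h.exists_parRed_iterate
  refine ⟨k, ?_⟩
  generalize (fun z => z.bind STerm.dev)^[k] x = d at hk
  induction hk with
  | refl => rfl
  | tail _ h ih => exact (ih ▸ h).eq_of_normal hc

theorem Red.eq_of_normal {x c d : Multiset STerm} (hc : Red x c) (hd : Red x d)
    (hc' : ∀ t ∈ c, t.Normal) (hd' : ∀ t ∈ d, t.Normal) : c = d := by
  obtain ⟨k, hk⟩ := hc.exists_iterate_dev_eq hc'
  obtain ⟨l, hl⟩ := hd.exists_iterate_dev_eq hd'
  have key {c d : Multiset STerm} {k l : ℕ} (hc' : ∀ t ∈ c, t.Normal)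
      (hk : (fun z => z.bind STerm.dev)^[k] x = c) (hl : (fun z => z.bind STerm.dev)^[l] x = d)
      (h : k ≤ l) : c = d := by
    obtain ⟨m, rfl⟩ := Nat.exists_eq_add_of_le' h
    rw [Function.iterate_add_apply, hk] at hl
    rw [← hl]
    -- Every sum reduces in parallel to its development, so a normal one is fixed by it.
    exact (Function.iterate_fixed ((ParRed.refl c).dev.eq_of_normal hc') m).symm
  rcases le_total k l with h | h
  · exact key hc' hk hl h
  · exact (key hd' hl hk h).symm

/-! ### Existence of normal forms -/

theorem Red01.refl (x : Multiset STerm) : Red01 x x := by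
  induction x using Multiset.induction_on with
  | empty => exact ⟨[], by simp⟩
  | cons s x ih =>
    obtain ⟨l, hl, h₁, h₂⟩ := ih
    refine ⟨(s, {s}) :: l, ?_, by simp [← h₁], by simp [h₂]⟩
    rintro q hq
    rcases List.mem_cons.1 hq with rfl | hq
    · exact .inl rfl
    · exact hl q hq

theorem Red01.add {x y z w : Multiset STerm} (h : Red01 x y) (h' : Red01 z w) :
    Red01 (x + z) (y + w) := by
  obtain ⟨l, hl, rfl, rfl⟩ := h
  obtain ⟨l', hl', rfl, rfl⟩ := h'
  refine ⟨l ++ l', fun q hq => ?_, by simp, by simp⟩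
  exact (List.mem_append.1 hq).elim (hl q) (hl' q)

theorem Red.refl (x : Multiset STerm) : Red x x := .single (.refl x)

theorem Red.add {x y z w : Multiset STerm} (h : Red x y) (h' : Red z w) :
    Red (x + z) (y + w) :=
  (Relation.TransGen.lift (r := Red01) (· + z) (fun _ _ h => Red01.add h (.refl z)) x y h).trans
    (Relation.TransGen.lift (r := Red01) (y + ·) (fun _ _ h => Red01.add (.refl y) h) z w h')

theorem Red.bind {x : Multiset STerm} {f : STerm → Multiset STerm} (h : ∀ t ∈ x, Red {t} (f t)) :
    Red x (x.bind f) := by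
  induction x using Multiset.induction_on with
  | empty => exact .refl 0
  | cons s x ih =>
    simpa using (h s (by simp)).add (ih fun t ht => h t (Multiset.mem_cons_of_mem ht))

theorem STerm.Step.red {s : STerm} {b : Multiset STerm} (h : s.Step b) : Red {s} b :=
  .single ⟨[(s, b)], by simp [h], by simp, by simp⟩

theorem STerm.exists_isNormalForm (s : STerm) : ∃ c, s.IsNormalForm c := by
  induction hn : s.size using Nat.strong_induction_on generalizing s with
  | _ n ih =>
    by_cases hs : s.Normal
    · exact ⟨{s}, .refl _, by simpa using hs⟩
    · obtain ⟨b, hb⟩ : ∃ b, s.Step b := by simpa [STerm.Normal] using hs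
      -- Membership is placed under the existential so that `choose` yields a total function; its
      -- value outside `b` is irrelevant.
      have h (t : STerm) : ∃ c, t ∈ b → t.IsNormalForm c := by
        by_cases ht : t ∈ b
        · obtain ⟨c, hc⟩ := ih _ (hn ▸ hb.size_lt t ht) t rfl
          exact ⟨c, fun _ => hc⟩
        · exact ⟨0, fun h => absurd h ht⟩
      choose f hf using h
      refine ⟨b.bind f, hb.red.trans (Red.bind fun t ht => (hf t ht).1), fun t ht => ?_⟩
      obtain ⟨u, hu, ht⟩ := Multiset.mem_bind.1 ht
      exact (hf u hu).2 t ht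

theorem STerm.IsNormalForm.unique {s : STerm} {c d : Multiset STerm} (hc : s.IsNormalForm c)
    (hd : s.IsNormalForm d) : c = d := hc.1.eq_of_normal hd.1 hc.2 hd.2

theorem STerm.isNormalForm_nf (s : STerm) : s.IsNormalForm s.nf := by
  rw [STerm.nf, dif_pos s.exists_isNormalForm]
  exact s.exists_isNormalForm.choose_spec

/-- Normalizing every summand of `c` extends the reduction to a normal form of `s`, and normal forms
are unique. -/
theorem STerm.nf_eq_bind_of_red {s : STerm} {c : Multiset STerm} (h : Red {s} c) :
    s.nf = c.bind STerm.nf := by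
  refine s.isNormalForm_nf.unique ⟨h.trans (Red.bind fun t _ => t.isNormalForm_nf.1), fun t ht => ?_⟩
  obtain ⟨u, -, ht⟩ := Multiset.mem_bind.1 ht
  exact u.isNormalForm_nf.2 t ht

/-! ### Finitary vectors -/

theorem VecStep.NF_eq {K : Type*} [Field K] {a b : FinVec K} (h : VecStep a b) :
    NF a = NF b := by
  classical
  obtain ⟨α, s, c, hs, hfin, hc, ha, hb⟩ := h
  have hred (i : ℕ) : Red {s i} (c i) := .single (hc i)
  refine Subtype.ext (funext fun t => ?_)
  let N (u : STerm) : K := (u.nf.count t : K)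
  have hN {u : STerm} (hu : N u ≠ 0) : t ∈ u.nf :=
    Multiset.count_ne_zero.1 fun h => hu (by simp [N, h])
  have hI : {i | s i ∈ t.up}.Finite :=
    ((hs t.up ⟨t, rfl⟩).biUnion fun u _ => hfin u).subset fun i hi => by
      simpa using hi
  -- If `t` occurs in the normal form of a summand of `c i`, it occurs in that of `s i`, so `s i ≥
  -- t`.
  have hup {u : STerm} {i : ℕ} (hu : u ∈ c i) (ht : t ∈ u.nf) : i ∈ hI.toFinset := by
    rw [Set.Finite.mem_toFinset]
    refine ⟨(s i).nf, (s i).isNormalForm_nf.1, ?_⟩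
    rw [STerm.nf_eq_bind_of_red (hred i)]
    exact Multiset.mem_bind.2 ⟨u, hu, ht⟩
  -- One exchange of sums serves both vectors: `f i` is the `i`-th summand of `a` or of `b`, and
  -- only indices in the finite set `hI` contribute to the coefficient at `t`.
  have key (f : ℕ → STerm → K)
      (hf' : ∀ i, (f i).support.Finite) (hI' : ∀ i u, f i u ≠ 0 → t ∈ u.nf → i ∈ hI.toFinset) :
      ∑ᶠ u, (∑ᶠ i, f i u) * N u = ∑ i ∈ hI.toFinset, ∑ᶠ u, f i u * N u := by
    rw [← finsum_sum_comm]
    · refine finsum_congr fun u => ?_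
      rw [finsum_mul]
      refine finsum_eq_sum_of_support_subset _ fun i hi => ?_
      exact hI' i u (left_ne_zero_of_mul hi) (hN (right_ne_zero_of_mul hi))
    · exact fun i _ => (hf' i).subset fun u hu => left_ne_zero_of_mul hu
  have ha' : (NF a).1 t = ∑ᶠ u, (∑ᶠ i, if s i = u then α i else 0) * N u :=
    finsum_congr fun u => by rw [ha u]
  have hb' : (NF b).1 t = ∑ᶠ u, (∑ᶠ i, α i * ((c i).count u : K)) * N u :=
    finsum_congr fun u => by rw [hb u]
  rw [ha', hb', key, key]
  · refine Finset.sum_congr rfl fun i _ => ?_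
    rw [finsum_eq_single _ (s i) fun u hu => by rw [if_neg hu.symm, zero_mul], if_pos rfl]
    have h₁ : N (s i) = ∑ u ∈ (c i).toFinset, ((c i).count u : K) * N u := by
      simp only [N]
      rw [STerm.nf_eq_bind_of_red (hred i), Multiset.count_bind,
        Finset.sum_multiset_map_count]
      simp
    rw [finsum_eq_sum_of_support_subset (s := (c i).toFinset), h₁, Finset.mul_sum]
    · exact Finset.sum_congr rfl fun u _ => (mul_assoc _ _ _).symm
    · intro u hu
      have : ((c i).count u : K) ≠ 0 := right_ne_zero_of_mul (left_ne_zero_of_mul hu)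
      rw [Finset.mem_coe, Multiset.mem_toFinset, ← Multiset.count_ne_zero]
      exact fun h => this (by simp [h])
  · intro i
    refine (c i).toFinset.finite_toSet.subset fun u hu => ?_
    have : ((c i).count u : K) ≠ 0 := right_ne_zero_of_mul hu
    rw [Finset.mem_coe, Multiset.mem_toFinset, ← Multiset.count_ne_zero]
    exact fun h => this (by simp [h])
  · intro i u hu
    refine hup (Multiset.count_ne_zero.1 fun h => right_ne_zero_of_mul hu (by simp [h]))
  · intro i
    refine (Set.finite_singleton (s i)).subset fun u hu => ?_
    by_contra h
    exact hu (if_neg fun h' => h h'.symm)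
  · intro i u hu ht
    obtain rfl : s i = u := by
      by_contra h
      exact hu (if_neg h)
    rw [Set.Finite.mem_toFinset]
    exact ⟨(s i).nf, (s i).isNormalForm_nf.1, ht⟩

theorem VecEquiv.NF_eq {K : Type*} [Field K] {a b : FinVec K} (h : VecEquiv a b) :
    NF a = NF b := by
  induction h with
  | rel _ _ h =>
    induction h with
    | single h => exact h.NF_eq
    | tail _ h ih => exact ih.trans h.NF_eq
  | refl _ => rfl
  | symm _ _ _ ih => exact ih.symm
  | trans _ _ _ _ _ ih ih' => exact ih.trans ih'

theorem mainTheorem4 {K : Type*} [Field K] :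
    (∀ s : STerm, ∃! c : Multiset STerm, s.IsNormalForm c) ∧
    ∀ a b : FinVec K, VecEquiv a b → NF a = NF b :=
  ⟨fun s => ⟨s.nf, s.isNormalForm_nf, fun _ h => h.unique s.isNormalForm_nf⟩,
    fun _ _ h => h.NF_eq⟩
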